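/- **Setting.** There are $n\ge 1$ candidates; candidate $i$ has a receiver value $\rho_i\ge 0$ and a sender value $\xi_i\ge 0$, where the $\rho_i$ are pairwise distinct and the $\xi_i$ are pairwise distinct. Sender and receiver both know all these pairs. The candidates arrive one per round in uniformly random order. In round $t$ the sender observes the arriving candidate $\theta_t$ and sends a signal $\sigma_t\in\{\mathrm{HIRE},\mathrm{NOT}\}$ according to a (possibly randomized) mechanism $\phi$, known to the receiver, that depends on $\theta_1,\dots,\theta_t$ and on internal randomness; the receiver then irrevocably hires $\theta_t$ (which ends the process) or rejects it. The receiver's decision in round $t$ is based on $\sigma_1,\dots,\sigma_t$ and, *with disclosure*, also on the rejected candidates $\theta_1,\dots,\theta_{t-1}$. The receiver maximizes the expected value $\rho$ of the hired candidate (0 if nobody is hired). A mechanism is *persuasive* if obedience (hiring exactly upon a HIRE signal) maximizes the receiver's expected utility among all her strategies. The sender has ordinal utility: the *success probability* of a mechanism is the probability that an obedient receiver hires the sender-optimal candidate, i.e. the one with maximum $\xi_i$. $\mathrm{OPT}$ denotes the supremum of the success probabilities of all mechanisms that are persuasive *without* disclosure. **Mechanism.** For a nonempty set $R$ of candidates with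 sender-optimal candidate $c$, put $\xi'_c=1$, $\xi'_i=0$ for $i\in R\setminus\{c\}$, let $\rho'$ be $\rho$ scaled to maximum $1$ on $R$ (left as it is if $\rho$ vanishes on $R$), and let $\mu=\frac1{|R|}\sum_{i\in R}\rho'_i$. The *Pareto procedure* on $R$ returns $c$ if $\rho'_c\ge\mu$. Otherwise it takes candidates $a,b\in R$ such that the segment between $(\rho'_a,\xi'_a)$ and $(\rho'_b,\xi'_b)$ lies on the Pareto frontier of the convex hull of $\{(\rho'_i,\xi'_i): i\in R\}$ and meets the line $\rho'=\mu$, and returns $a$ with probability $\frac{\mu-\rho'_b}{\rho'_a-\rho'_b}$ and $b$ otherwise. The *Shrinking Pareto mechanism* runs the Pareto procedure in every round $t$, with fresh randomness, on the set $R_t$ of candidates that have not been rejected so far (including $\theta_t$); it signals HIRE if the procedure returns $\theta_t$, and NOT otherwise; after its first HIRE signal it signals NOT forever. **Theorem.** 1. For every $n\ge1$ and every such instance with $n$ candidates, the Shrinking Pareto mechanism is persuasive with disclosure, and its success probability is at least $$\mathrm{OPT}\cdot\left(\frac12-\frac1{2n}\right).$$ 2. This is asymptotically optimal: for every $\varepsilon>0$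 there is an $N$ such that for every $n\ge N$ there is an instance with $n$ candidates in which every mechanism that is persuasive with disclosure has success probability at most $\left(\frac12+\varepsilon\right)\mathrm{OPT}$. -/

import Mathlib

open scoped BigOperators

namespace OnlinePersuasion

/-- The valuation pairs of the candidates: nonnegative, receiver values pairwise distinct, sender
values pairwise distinct. -/
structure IsInstance {n : ℕ} (ρ ξ : Fin n → ℝ) : Prop where
  rho_nonneg : ∀ i, 0 ≤ ρ i
  xi_nonneg : ∀ i, 0 ≤ ξ i
  rho_injective : Function.Injective ρ
  xi_injective : Function.Injective ξ

/-! ### Signaling mechanisms and receiver strategies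

A signal is a `Bool`, `true` meaning HIRE. All histories are lists with the newest entry first. -/

/-- A (randomized) direct signaling mechanism. In round `t` it signals HIRE with probability
`hireProb [θ_t, …, θ_1] [σ_{t-1}, …, σ_1]`, given the candidates `θ_1, …, θ_t` that arrived so far
and the signals `σ_1, …, σ_{t-1}` sent so far. Through the earlier signals the internal
randomization of different rounds may be correlated arbitrarily. -/
structure Mechanism (n : ℕ) where
  hireProb : List (Fin n) → List Bool → ℝ
  hireProb_nonneg : ∀ θ σ, 0 ≤ hireProb θ σ
  hireProb_le_one : ∀ θ σ, hireProb θ σ ≤ 1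

/-- The probability of sending the signal `s`. -/
def Mechanism.signalProb {n : ℕ} (φ : Mechanism n) (θ : List (Fin n)) (σ : List Bool)
    (s : Bool) : ℝ :=
  if s then φ.hireProb θ σ else 1 - φ.hireProb θ σ

/-- A strategy of the receiver with disclosure: from the rejected candidates
`[θ_{t-1}, …, θ_1]` and the signals `[σ_t, …, σ_1]` it decides whether to hire in round `t`. -/
abbrev Strategy (n : ℕ) : Type := List (Fin n) → List Bool → Bool

/-- Hire exactly when the current signal is HIRE. -/
def obedient {n : ℕ} : Strategy n
  | _, [] => false
  | _, s :: _ => s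

/-- The expectation, over the randomization of `φ`, of the value `v` of the hired candidate
(0 if nobody is hired), when the candidates in `past` have been rejected after the signals `σ` and
the candidates in the last argument arrive next, in this order. -/
def valueAlong {n : ℕ} (φ : Mechanism n) (r : Strategy n) (v : Fin n → ℝ) :
    List (Fin n) → List Bool → List (Fin n) → ℝ
  | _, _, [] => 0
  | past, σ, i :: rest =>
      ∑ s : Bool, φ.signalProb (i :: past) σ s *
        (if r past (s :: σ) then v i else valueAlong φ r v (i :: past) (s :: σ) rest)

/-- The expected value `v` of the hired candidate under uniformly random arrival order. -/
noncomputable def expectedValue {n : ℕ} (φ : Mechanism n) (r : Strategy n) (v : Fin n → ℝ) : ℝ :=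
  (∑ π : Equiv.Perm (Fin n), valueAlong φ r v [] [] (List.ofFn π)) / (Nat.factorial n : ℝ)

/-- Persuasiveness in the scenario with disclosure, for a receiver with cardinal utility `ρ`:
obedience maximizes the receiver's expected utility among all her strategies. As a strategy may
deviate from obedience at (and after) one single round and observed history only, this says that
obedience is optimal in every round, conditionally on every history that has positive probability
under obedience. -/
def PersuasiveWithDisclosure {n : ℕ} (ρ : Fin n → ℝ) (φ : Mechanism n) : Prop :=
  ∀ r : Strategy n, expectedValue φ r ρ ≤ expectedValue φ obedient ρ

/-- Persuasiveness in the scenario without disclosure: the receiver's decisions can depend on the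
signals only. -/
def PersuasiveWithoutDisclosure {n : ℕ} (ρ : Fin n → ℝ) (φ : Mechanism n) : Prop :=
  ∀ r : List Bool → Bool, expectedValue φ (fun _ σ => r σ) ρ ≤ expectedValue φ obedient ρ

/-! ### Ordinal sender utility and the benchmark -/

/-- `c` is a sender-optimal candidate of the set `R`. -/
def IsSenderBest {n : ℕ} (R : Finset (Fin n)) (ξ : Fin n → ℝ) (c : Fin n) : Prop :=
  c ∈ R ∧ ∀ j ∈ R, ξ j ≤ ξ c

open Classical in
/-- Ordinal sender utility on `R`: 1 for the sender-optimal candidate and 0 for all others. -/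
noncomputable def ordinalUtility {n : ℕ} (R : Finset (Fin n)) (ξ : Fin n → ℝ) (i : Fin n) : ℝ :=
  if IsSenderBest R ξ i then 1 else 0

/-- The probability that the sender-optimal candidate is hired by an obedient receiver. -/
noncomputable def successProb {n : ℕ} (ξ : Fin n → ℝ) (φ : Mechanism n) : ℝ :=
  expectedValue φ obedient (ordinalUtility Finset.univ ξ)

/-- The benchmark: the optimal success probability of persuasive mechanisms in the basic scenario
without disclosure. -/
noncomputable def OPT {n : ℕ} (ρ ξ : Fin n → ℝ) : ℝ :=
  sSup {p : ℝ | ∃ φ : Mechanism n, PersuasiveWithoutDisclosure ρ φ ∧ p = successProb ξ φ}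

/-! ### The Pareto procedure -/

/-- The average receiver value of the candidates in `R`. -/
noncomputable def mean {n : ℕ} (R : Finset (Fin n)) (ρ : Fin n → ℝ) : ℝ :=
  (∑ i ∈ R, ρ i) / (R.card : ℝ)

/-- The Pareto frontier of the convex hull of the valuation pairs `(ρ i, ξ i)`, `i ∈ R`. -/
def paretoCurve {n : ℕ} (R : Finset (Fin n)) (ρ ξ : Fin n → ℝ) : Set (ℝ × ℝ) :=
  {p | Maximal (· ∈ convexHull ℝ ((fun i => (ρ i, ξ i)) '' (R : Set (Fin n)))) p}

/-- The pairs `(a, b)` that the Pareto procedure can select on input `R`: if the sender-optimal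
candidate has at least average receiver value, `a = b` is this candidate; otherwise the segment from
`a` to `b` is part of the Pareto frontier and meets the vertical line at the average receiver
value. -/
def IsParetoPair {n : ℕ} (R : Finset (Fin n)) (ρ ξ : Fin n → ℝ) (a b : Fin n) : Prop :=
  (IsSenderBest R ξ a ∧ mean R ρ ≤ ρ a ∧ b = a) ∨
  ((∀ c, IsSenderBest R ξ c → ρ c < mean R ρ) ∧ a ∈ R ∧ b ∈ R ∧
    segment ℝ (ρ a, ξ a) (ρ b, ξ b) ⊆ paretoCurve R ρ ξ ∧
    ∃ p ∈ segment ℝ (ρ a, ξ a) (ρ b, ξ b), p.1 = mean R ρ)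

open Classical in
/-- The threshold `α` computed by the Pareto procedure. -/
noncomputable def paretoAlpha {n : ℕ} (R : Finset (Fin n)) (ρ ξ : Fin n → ℝ) (a b : Fin n) : ℝ :=
  if ρ a = ρ b then 1 else if ξ a = ξ b then 0 else (mean R ρ - ρ b) / (ρ a - ρ b)

open Classical in
/-- The distribution of the candidate returned by the Pareto procedure on `R`: `a` if a uniform
number from `[0, 1]` is at most `α` (which has probability `max 0 (min 1 α)`), and `b` otherwise. -/
noncomputable def paretoLottery {n : ℕ} (R : Finset (Fin n)) (ρ ξ : Fin n → ℝ) (i : Fin n) : ℝ :=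
  if h : ∃ p : Fin n × Fin n, IsParetoPair R ρ ξ p.1 p.2 then
    let a := h.choose.1
    let b := h.choose.2
    let q := max 0 (min 1 (paretoAlpha R ρ ξ a b))
    (if i = a then q else 0) + (if i = b then 1 - q else 0)
  else 0

/-- The Pareto procedure for ordinal sender utility: receiver values are scaled to maximum 1 on `R`,
sender values are replaced by 1 for the sender-optimal candidate of `R` and 0 for the others. -/
noncomputable def ordinalParetoLottery {n : ℕ} (ρ ξ : Fin n → ℝ) (R : Finset (Fin n)) :
    Fin n → ℝ :=
  paretoLottery R (fun i => ρ i / sSup (ρ '' (R : Set (Fin n)))) (ordinalUtility R ξ)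

theorem paretoLottery_mem {n : ℕ} (R : Finset (Fin n)) (ρ ξ : Fin n → ℝ) (i : Fin n) :
    0 ≤ paretoLottery R ρ ξ i ∧ paretoLottery R ρ ξ i ≤ 1 := by
  have key : ∀ (a b : Fin n) (q : ℝ), 0 ≤ q → q ≤ 1 →
      0 ≤ (if i = a then q else 0) + (if i = b then 1 - q else 0) ∧
        (if i = a then q else 0) + (if i = b then 1 - q else 0) ≤ 1 := by
    intro a b q h0 h1
    split_ifs <;> constructor <;> linarith
  unfold paretoLottery
  split_ifs with h
  · exact key _ _ _ (le_max_left _ _) (max_le zero_le_one (min_le_left _ _))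
  · exact ⟨le_rfl, zero_le_one⟩

/-! ### The Shrinking Pareto mechanism -/

/-- With `i` arriving after the candidates in `past`, the set of remaining candidates (including
`i`) is the complement of `past`. The mechanism runs the Pareto procedure on this set, with fresh
randomness, and signals HIRE iff the procedure returns `i`. Once it has signaled HIRE it never does
so again. -/
noncomputable def shrinkingParetoHireProb {n : ℕ} (ρ ξ : Fin n → ℝ) :
    List (Fin n) → List Bool → ℝ
  | [], _ => 0
  | i :: past, σ =>
      if true ∈ σ then 0 else ordinalParetoLottery ρ ξ (Finset.univ \ past.toFinset) i

/-- The Shrinking Pareto mechanism for ordinal sender utility. -/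
noncomputable def shrinkingPareto {n : ℕ} (ρ ξ : Fin n → ℝ) : Mechanism n where
  hireProb := shrinkingParetoHireProb ρ ξ
  hireProb_nonneg := by
    intro θ σ
    cases θ with
    | nil => exact le_rfl
    | cons i past =>
      simp only [shrinkingParetoHireProb]
      split_ifs
      · exact le_rfl
      · exact (paretoLottery_mem _ _ _ _).1
  hireProb_le_one := by
    intro θ σ
    cases θ with
    | nil => exact zero_le_one
    | cons i past =>
      simp only [shrinkingParetoHireProb]
      split_ifs
      · exact zero_le_one
      · exact (paretoLottery_mem _ _ _ _).2

end OnlinePersuasion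

/-!
On a set `R` with sender-optimal candidate `c` and receiver-optimal candidate `M`, the Pareto
procedure is a lottery on `c` and `M` whose expected receiver value is at least the mean of `R`.
Under a mechanism that follows such lotteries on the shrinking sets, obedience is worth at least the
mean of the remaining candidates as long as no HIRE signal was sent, while afterwards the signals
carry no information and no strategy is worth more than this mean. Hence the mechanism is persuasive
with disclosure.

`OPT` is the probability with which the Pareto lottery on the full set returns `c`. Without
disclosure this is attained by drawing a candidate from the lottery in advance and signaling HIRE
upon its arrival, as the arrival time is independent of the drawn candidate. It cannot be exceeded,
as the receiver can secure the mean by hiring the first candidate. The Shrinking Pareto mechanism is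
compared with this benchmark by induction on the number `k` of remaining candidates: writing `p R i`
for the probability that the procedure on `R` returns `i`, rejecting the first arrival costs only
the factor in `∑ i ≠ c, (1 - p R i) * p (R \ {i}) c ≥ p R c * (k - 1) * (k - 3) / (k - 2)`, where
`k ≥ 3`.

In the hard instance the sender-optimal candidate `c` is worthless, another candidate has value `1`
and all others have value almost `1 - h`, so that `OPT` is about `h`. Suppose that the receiver, as
long as `c` has not been rejected, answers HIRE by rejecting and hiring the next candidate instead.
If `c` were worth `1 - h`, this would lose at most `h` in the case that the candidate of value `1`
arrives before `c`, hence `h / 2`, up to `O(1 / n)`. As `c` is worthless, it gains `1 - h` whenever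
obedience would hire `c`, so a persuasive mechanism has success probability about
`h / (2 * (1 - h))` at most.
-/

namespace OnlinePersuasion

section Orderings

variable {α : Type*}

/-- The enumerations of `R` without repetition, that is, the possible arrival orders. -/
def orderings [DecidableEq α] (R : Finset α) : Finset (List α) :=
  ⟨R.val.lists, Multiset.lists_nodup_finset R⟩

variable [DecidableEq α]

theorem mem_orderings {R : Finset α} {l : List α} : l ∈ orderings R ↔ R.val = l :=
  Multiset.mem_lists_iff R.val l

theorem card_orderings (R : Finset α) : (orderings R).card = R.card.factorial := by
  obtain ⟨l, hl⟩ := Quot.exists_rep R.val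
  have hcard : R.card = l.length := by rw [Finset.card_def, ← hl]; rfl
  change Multiset.card R.val.lists = _
  rw [hcard, ← hl]
  exact (congrArg Multiset.card (Multiset.lists_coe l)).trans (List.length_permutations l)

theorem cons_mem_orderings {R : Finset α} {i : α} {l : List α} :
    i :: l ∈ orderings R ↔ i ∈ R ∧ l ∈ orderings (R.erase i) := by
  simp only [mem_orderings, Finset.erase_val, ← Multiset.cons_coe]
  constructor
  · intro h
    have hi : i ∈ R := by rw [Finset.mem_def, h]; exact Multiset.mem_cons_self i _
    exact ⟨hi, by rw [h, Multiset.erase_cons_head]⟩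
  · rintro ⟨hi, h⟩
    rw [← h, Multiset.cons_erase hi]

theorem sum_orderings {M : Type*} [AddCommMonoid M] {R : Finset α} (hR : R.Nonempty)
    (f : List α → M) :
    ∑ l ∈ orderings R, f l = ∑ i ∈ R, ∑ l ∈ orderings (R.erase i), f (i :: l) := by
  rw [Finset.sum_sigma']
  refine (Finset.sum_bij (fun x _ => x.1 :: x.2) ?_ ?_ ?_ fun _ _ => rfl).symm
  · rintro ⟨i, l⟩ h
    exact cons_mem_orderings.2 (Finset.mem_sigma.1 h)
  · rintro ⟨i, l⟩ - ⟨j, k⟩ - h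
    obtain ⟨rfl, rfl⟩ := List.cons.inj h
    rfl
  · rintro (_ | ⟨i, l⟩) h
    · exact absurd (Finset.val_eq_zero.1 (mem_orderings.1 h)) hR.ne_empty
    · exact ⟨⟨i, l⟩, Finset.mem_sigma.2 (cons_mem_orderings.1 h), rfl⟩

theorem expect_orderings {R : Finset α} (hR : R.Nonempty) (f : List α → ℝ) :
    𝔼 l ∈ orderings R, f l = 𝔼 i ∈ R, 𝔼 l ∈ orderings (R.erase i), f (i :: l) := by
  simp only [Finset.expect_eq_sum_div_card, card_orderings, sum_orderings hR]
  rw [← Nat.mul_factorial_pred hR.card_ne_zero, Nat.cast_mul, mul_comm, ← div_div, Finset.sum_div]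
  exact congrArg (· / (R.card : ℝ))
    (Finset.sum_congr rfl fun i hi => by rw [Finset.card_erase_of_mem hi])

theorem expect_perm_ofFn {n : ℕ} (f : List (Fin n) → ℝ) :
    𝔼 π : Equiv.Perm (Fin n), f (List.ofFn π) = 𝔼 l ∈ orderings Finset.univ, f l := by
  have hinj : Function.Injective fun π : Equiv.Perm (Fin n) => List.ofFn π :=
    fun _ _ h => DFunLike.coe_injective (List.ofFn_injective h)
  have himage : Finset.univ.image (fun π : Equiv.Perm (Fin n) => List.ofFn π) =
      orderings Finset.univ := by
    refine Finset.eq_of_subset_of_card_le (Finset.image_subset_iff.2 fun π _ => ?_) ?_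
    · refine mem_orderings.2 (Multiset.Nodup.ext Finset.univ.nodup ?_ |>.2 fun i => ?_)
      · exact Multiset.coe_nodup.2 (List.nodup_ofFn.2 π.injective)
      · simpa using π.surjective i
    · rw [card_orderings, Finset.card_image_of_injective _ hinj, Finset.card_univ,
        Finset.card_univ, Fintype.card_perm]
  rw [← himage, Finset.expect_image hinj.injOn]

end Orderings

section ContinuationValues

variable {n : ℕ}

/-- The candidates that have not arrived when those in `past` have. -/
def remaining (past : List (Fin n)) : Finset (Fin n) :=
  Finset.univ \ past.toFinset

theorem mem_remaining {past : List (Fin n)} {i : Fin n} : i ∈ remaining past ↔ i ∉ past := by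
  simp [remaining]

theorem remaining_nil : remaining ([] : List (Fin n)) = Finset.univ := by
  simp [remaining]

theorem remaining_cons (i : Fin n) (past : List (Fin n)) :
    remaining (i :: past) = (remaining past).erase i := by
  simp only [remaining, List.toFinset_cons, Finset.sdiff_insert]

@[elab_as_elim]
theorem arrival_induction {motive : List (Fin n) → Prop}
    (step : ∀ past, (∀ i ∈ remaining past, motive (i :: past)) → motive past)
    (past : List (Fin n)) : motive past := by
  induction hm : (remaining past).card using Nat.strong_induction_on generalizing past with
  | _ m ih =>
    refine step past fun i hi => ih _ ?_ (i :: past) rfl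
    rw [← hm, remaining_cons]
    exact Finset.card_erase_lt_of_mem hi

theorem mean_eq_expect (R : Finset (Fin n)) (v : Fin n → ℝ) : mean R v = 𝔼 i ∈ R, v i :=
  (Finset.expect_eq_sum_div_card R v).symm

theorem card_mul_mean (R : Finset (Fin n)) (v : Fin n → ℝ) : R.card * mean R v = ∑ i ∈ R, v i := by
  rw [mean_eq_expect, Finset.card_mul_expect]

theorem Mechanism.signalProb_nonneg (φ : Mechanism n) (θ : List (Fin n)) (σ : List Bool)
    (s : Bool) : 0 ≤ φ.signalProb θ σ s := by
  cases s
  · exact sub_nonneg.2 (φ.hireProb_le_one θ σ)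
  · exact φ.hireProb_nonneg θ σ

theorem Mechanism.sum_signalProb (φ : Mechanism n) (θ : List (Fin n)) (σ : List Bool) :
    ∑ s, φ.signalProb θ σ s = 1 := by
  simp [signalProb]

/-- The expected value of the hired candidate once those in `past` have been rejected after the
signals `σ`, the others arriving in uniformly random order. -/
noncomputable def continuationValue (φ : Mechanism n) (r : Strategy n) (v : Fin n → ℝ)
    (past : List (Fin n)) (σ : List Bool) : ℝ :=
  𝔼 l ∈ orderings (remaining past), valueAlong φ r v past σ l

variable (φ : Mechanism n) (r : Strategy n)

theorem expectedValue_eq_expect (v : Fin n → ℝ) :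
    expectedValue φ r v = 𝔼 l ∈ orderings Finset.univ, valueAlong φ r v [] [] l := by
  rw [← expect_perm_ofFn, Fintype.expect_eq_sum_div_card, Fintype.card_perm, Fintype.card_fin]
  rfl

theorem expectedValue_eq_continuationValue (v : Fin n → ℝ) :
    expectedValue φ r v = continuationValue φ r v [] [] := by
  rw [expectedValue_eq_expect, continuationValue, remaining_nil]

theorem continuationValue_eq_expect (v : Fin n → ℝ) (past : List (Fin n)) (σ : List Bool) :
    continuationValue φ r v past σ = 𝔼 i ∈ remaining past, ∑ s, φ.signalProb (i :: past) σ s *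
      if r past (s :: σ) then v i else continuationValue φ r v (i :: past) (s :: σ) := by
  rcases (remaining past).eq_empty_or_nonempty with hR | hR
  · simp only [continuationValue, hR, Finset.expect_empty]
    refine Finset.expect_eq_zero fun l hl => ?_
    rw [(Multiset.coe_eq_zero l).1 (mem_orderings.1 hl).symm, valueAlong]
  · rw [continuationValue, expect_orderings hR]
    refine Finset.expect_congr rfl fun i _ => ?_
    have horders : (orderings ((remaining past).erase i)).Nonempty :=
      Finset.card_pos.1 (card_orderings ((remaining past).erase i) ▸ Nat.factorial_pos _)
    simp only [valueAlong, Finset.expect_sum_comm, ← Finset.mul_expect]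
    refine Finset.sum_congr rfl fun s _ => ?_
    split_ifs
    · rw [Finset.expect_const horders]
    · rw [continuationValue, remaining_cons]

theorem continuationValue_obedient (v : Fin n → ℝ) (past : List (Fin n)) (σ : List Bool) :
    continuationValue φ obedient v past σ = 𝔼 i ∈ remaining past,
      (φ.hireProb (i :: past) σ * v i + (1 - φ.hireProb (i :: past) σ) *
        continuationValue φ obedient v (i :: past) (false :: σ)) := by
  rw [continuationValue_eq_expect]
  simp [obedient, Mechanism.signalProb]

theorem continuationValue_congr {v w : Fin n → ℝ} {past : List (Fin n)}
    (h : ∀ i ∈ remaining past, v i = w i) (σ : List Bool) :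
    continuationValue φ r v past σ = continuationValue φ r w past σ := by
  induction past using arrival_induction generalizing σ with
  | step past ih =>
    rw [continuationValue_eq_expect, continuationValue_eq_expect]
    refine Finset.expect_congr rfl fun i hi => Finset.sum_congr rfl fun s _ => ?_
    rw [h i hi, ih i hi fun j hj => h j (Finset.mem_of_mem_erase (remaining_cons i past ▸ hj))]

theorem isLinearMap_continuationValue (past : List (Fin n)) (σ : List Bool) :
    IsLinearMap ℝ fun v => continuationValue φ r v past σ := by
  induction past using arrival_induction generalizing σ with
  | step past ih =>
    constructor
    · intro v w
      simp only [continuationValue_eq_expect φ r _ past, ← Finset.expect_add_distrib,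
        ← Finset.sum_add_distrib, ← mul_add]
      refine Finset.expect_congr rfl fun i hi => Finset.sum_congr rfl fun s _ => ?_
      split_ifs
      · rfl
      · rw [(ih i hi (s :: σ)).map_add]
    · intro a v
      simp only [continuationValue_eq_expect φ r _ past, smul_eq_mul, Finset.mul_expect,
        Finset.mul_sum]
      refine Finset.expect_congr rfl fun i hi => Finset.sum_congr rfl fun s _ => ?_
      rw [mul_left_comm]
      split_ifs
      · rfl
      · rw [(ih i hi (s :: σ)).map_smul, smul_eq_mul]

theorem continuationValue_le_of_forall_le {v : Fin n → ℝ} {b : ℝ} (hb : 0 ≤ b)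
    {past : List (Fin n)} (h : ∀ i ∈ remaining past, v i ≤ b) (σ : List Bool) :
    continuationValue φ r v past σ ≤ b := by
  induction past using arrival_induction generalizing σ with
  | step past ih =>
    rw [continuationValue_eq_expect]
    rcases (remaining past).eq_empty_or_nonempty with hR | hR
    · rwa [hR, Finset.expect_empty]
    · refine Finset.expect_le hR fun i hi => ?_
      calc _ ≤ ∑ s, φ.signalProb (i :: past) σ s * b := by
            refine Finset.sum_le_sum fun s _ =>
              mul_le_mul_of_nonneg_left ?_ (φ.signalProb_nonneg _ _ _)
            split_ifs
            · exact h i hi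
            · exact ih i hi
                (fun j hj => h j (Finset.mem_of_mem_erase (remaining_cons i past ▸ hj))) _
        _ = b := by rw [← Finset.sum_mul, φ.sum_signalProb, one_mul]

theorem continuationValue_nonneg {v : Fin n → ℝ} (hv : 0 ≤ v) (past : List (Fin n))
    (σ : List Bool) : 0 ≤ continuationValue φ r v past σ := by
  induction past using arrival_induction generalizing σ with
  | step past ih =>
    rw [continuationValue_eq_expect]
    refine Finset.expect_nonneg fun i hi => Finset.sum_nonneg fun s _ =>
      mul_nonneg (φ.signalProb_nonneg _ _ _) ?_
    split_ifs
    · exact hv i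
    · exact ih i hi _

variable {r} in
theorem continuationValue_of_forall_hire {past : List (Fin n)} {σ : List Bool}
    (h : ∀ s, r past (s :: σ) = true) (v : Fin n → ℝ) :
    continuationValue φ r v past σ = mean (remaining past) v := by
  rw [continuationValue_eq_expect, mean_eq_expect]
  simp only [h, if_true, ← Finset.sum_mul, φ.sum_signalProb, one_mul]

theorem isLinearMap_expectedValue : IsLinearMap ℝ (expectedValue φ r) := by
  simpa only [← expectedValue_eq_continuationValue] using isLinearMap_continuationValue φ r [] []

theorem expectedValue_le_of_forall_le {v : Fin n → ℝ} {b : ℝ} (hb : 0 ≤ b) (h : ∀ i, v i ≤ b) :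
    expectedValue φ r v ≤ b := by
  rw [expectedValue_eq_continuationValue]
  exact continuationValue_le_of_forall_le φ r hb (fun i _ => h i) []

theorem expectedValue_nonneg {v : Fin n → ℝ} (hv : 0 ≤ v) : 0 ≤ expectedValue φ r v := by
  rw [expectedValue_eq_continuationValue]
  exact continuationValue_nonneg φ r hv [] []

end ContinuationValues

section FavorableLotteries

variable {n : ℕ} {ρ : Fin n → ℝ}

/-- A probability distribution on `R` under which the expected receiver value is at least that of a
uniformly random candidate of `R`. -/
structure IsFavorableLottery (ρ : Fin n → ℝ) (R : Finset (Fin n)) (p : Fin n → ℝ) : Prop where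
  nonneg : ∀ i ∈ R, 0 ≤ p i
  sum_eq_one : ∑ i ∈ R, p i = 1
  mean_le : mean R ρ ≤ ∑ i ∈ R, p i * ρ i

theorem expect_le_expect_of_sum_le {α : Type*} {R : Finset α} {f g : α → ℝ}
    (h : ∑ i ∈ R, f i ≤ ∑ i ∈ R, g i) : 𝔼 i ∈ R, f i ≤ 𝔼 i ∈ R, g i := by
  simpa only [Finset.expect_eq_sum_div_card] using
    div_le_div_of_nonneg_right h (Nat.cast_nonneg R.card)

theorem sum_mul_mean_erase (R : Finset (Fin n)) (w v : Fin n → ℝ) :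
    ∑ i ∈ R, w i * mean (R.erase i) v =
      ((∑ i ∈ R, w i) * ∑ i ∈ R, v i - ∑ i ∈ R, w i * v i) / (R.card - 1) := by
  rw [Finset.sum_mul, ← Finset.sum_sub_distrib, Finset.sum_div]
  refine Finset.sum_congr rfl fun i hi => ?_
  rw [mean, Finset.cast_card_erase_of_mem hi, ← Finset.add_sum_erase R v hi]
  ring

theorem expect_mean_erase_le (hρ : ∀ i, 0 ≤ ρ i) (R : Finset (Fin n)) :
    𝔼 i ∈ R, mean (R.erase i) ρ ≤ mean R ρ := by
  rw [mean_eq_expect]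
  refine expect_le_expect_of_sum_le ?_
  have h := sum_mul_mean_erase R 1 ρ
  simp only [Pi.one_apply, one_mul, Finset.sum_const, nsmul_eq_mul, mul_one] at h
  rw [h, ← sub_one_mul, mul_div_right_comm]
  exact mul_le_of_le_one_left (Finset.sum_nonneg fun i _ => hρ i) (div_self_le_one _)

namespace IsFavorableLottery

variable {R : Finset (Fin n)} {p : Fin n → ℝ}

theorem nonempty (hp : IsFavorableLottery ρ R p) : R.Nonempty :=
  Finset.nonempty_of_sum_ne_zero (hp.sum_eq_one ▸ one_ne_zero)

theorem le_one (hp : IsFavorableLottery ρ R p) {i : Fin n} (hi : i ∈ R) : p i ≤ 1 :=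
  hp.sum_eq_one ▸ Finset.single_le_sum hp.nonneg hi

theorem sum_le_card_mul (hp : IsFavorableLottery ρ R p) :
    ∑ i ∈ R, ρ i ≤ R.card * ∑ i ∈ R, p i * ρ i := by
  rw [← card_mul_mean]
  exact mul_le_mul_of_nonneg_left hp.mean_le (Nat.cast_nonneg _)

theorem one_le_card (hp : IsFavorableLottery ρ R p) : (1 : ℝ) ≤ R.card :=
  Nat.one_le_cast.2 hp.nonempty.card_pos

theorem sum_mul_mean_erase_le (hp : IsFavorableLottery ρ R p) (hρ : ∀ i, 0 ≤ ρ i) :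
    ∑ i ∈ R, p i * mean (R.erase i) ρ ≤ ∑ i ∈ R, p i * ρ i := by
  rw [sum_mul_mean_erase, hp.sum_eq_one, one_mul]
  refine div_le_of_le_mul₀ (sub_nonneg.2 hp.one_le_card)
    (Finset.sum_nonneg fun i hi => mul_nonneg (hp.nonneg i hi) (hρ i)) ?_
  linarith [hp.sum_le_card_mul]

theorem sum_one_sub_mul_le (hp : IsFavorableLottery ρ R p) :
    ∑ i ∈ R, (1 - p i) * ρ i ≤ ∑ i ∈ R, (1 - p i) * mean (R.erase i) ρ := by
  have hS := hp.sum_le_card_mul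
  rw [sum_mul_mean_erase]
  simp only [sub_mul, one_mul, Finset.sum_sub_distrib, hp.sum_eq_one, Finset.sum_const,
    nsmul_eq_mul, mul_one]
  rcases hp.one_le_card.eq_or_lt with hm | hm
  · rw [← hm, one_mul] at hS
    rw [← hm, sub_self, div_zero]
    linarith
  · rw [le_div_iff₀ (sub_pos.2 hm)]
    linarith

end IsFavorableLottery

/-- The mechanism `φ` signals HIRE at most once: until then, `p R i` is the probability that it does
so for the arriving candidate `i` when the candidates in `R` (including `i`) are remaining. -/
def Mechanism.FollowsLottery (φ : Mechanism n) (p : Finset (Fin n) → Fin n → ℝ) : Prop :=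
  ∀ i past σ, φ.hireProb (i :: past) σ = if true ∈ σ then 0 else p (remaining past) i

variable {φ : Mechanism n} {p : Finset (Fin n) → Fin n → ℝ} {past : List (Fin n)} {σ : List Bool}

theorem Mechanism.FollowsLottery.continuationValue_le_mean (hφ : φ.FollowsLottery p)
    (hρ : ∀ i, 0 ≤ ρ i) (r : Strategy n) (hσ : true ∈ σ) :
    continuationValue φ r ρ past σ ≤ mean (remaining past) ρ := by
  induction past using arrival_induction generalizing σ with
  | step past ih =>
    have hrec : continuationValue φ r ρ past σ = 𝔼 i ∈ remaining past,
        if r past (false :: σ) then ρ i else continuationValue φ r ρ (i :: past) (false :: σ) := by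
      rw [continuationValue_eq_expect]
      simp [Mechanism.signalProb, hφ _ _ _, hσ]
    rw [hrec]
    split_ifs
    · rw [mean_eq_expect]
    · refine le_trans (Finset.expect_le_expect fun i hi => ?_)
        (expect_mean_erase_le hρ (remaining past))
      rw [← remaining_cons]
      exact ih i hi (List.mem_cons_of_mem _ hσ)

theorem Mechanism.FollowsLottery.continuationValue_obedient_eq (hφ : φ.FollowsLottery p)
    (v : Fin n → ℝ) (hσ : true ∉ σ) :
    continuationValue φ obedient v past σ =
      𝔼 i ∈ remaining past, (p (remaining past) i * v i + (1 - p (remaining past) i) *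
        continuationValue φ obedient v (i :: past) (false :: σ)) := by
  rw [continuationValue_obedient]
  simp only [hφ _ _ _, hσ, if_false]

theorem Mechanism.FollowsLottery.mean_le_continuationValue (hφ : φ.FollowsLottery p)
    (hp : ∀ R : Finset (Fin n), R.Nonempty → IsFavorableLottery ρ R (p R)) (hσ : true ∉ σ) :
    mean (remaining past) ρ ≤ continuationValue φ obedient ρ past σ := by
  induction past using arrival_induction generalizing σ with
  | step past ih =>
    rw [hφ.continuationValue_obedient_eq ρ hσ, mean_eq_expect]
    rcases (remaining past).eq_empty_or_nonempty with hR | hR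
    · rw [hR, Finset.expect_empty, Finset.expect_empty]
    set q := p (remaining past)
    have hq : IsFavorableLottery ρ (remaining past) q := hp _ hR
    calc 𝔼 i ∈ remaining past, ρ i
        = 𝔼 i ∈ remaining past, q i * ρ i + 𝔼 i ∈ remaining past, (1 - q i) * ρ i := by
          simp only [← Finset.expect_add_distrib, ← add_mul, add_sub_cancel, one_mul]
      _ ≤ 𝔼 i ∈ remaining past, q i * ρ i +
            𝔼 i ∈ remaining past, (1 - q i) * mean (remaining (i :: past)) ρ := by
          simp only [remaining_cons]
          exact add_le_add_right (expect_le_expect_of_sum_le hq.sum_one_sub_mul_le) _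
      _ ≤ _ := by
          rw [← Finset.expect_add_distrib]
          refine Finset.expect_le_expect fun i hi => add_le_add_right
            (mul_le_mul_of_nonneg_left (ih i hi ?_) (sub_nonneg.2 (hq.le_one hi))) _
          simpa using hσ

theorem Mechanism.FollowsLottery.continuationValue_le_obedient (hφ : φ.FollowsLottery p)
    (hp : ∀ R : Finset (Fin n), R.Nonempty → IsFavorableLottery ρ R (p R))
    (hρ : ∀ i, 0 ≤ ρ i) (r : Strategy n) (hσ : true ∉ σ) :
    continuationValue φ r ρ past σ ≤ continuationValue φ obedient ρ past σ := by
  induction past using arrival_induction generalizing σ with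
  | step past ih =>
    rw [hφ.continuationValue_obedient_eq ρ hσ, continuationValue_eq_expect]
    rcases (remaining past).eq_empty_or_nonempty with hR | hR
    · rw [hR, Finset.expect_empty, Finset.expect_empty]
    have hσ' : true ∉ false :: σ := by simpa using hσ
    set q := p (remaining past)
    have hq : IsFavorableLottery ρ (remaining past) q := hp _ hR
    simp only [Fintype.sum_bool, Mechanism.signalProb, hφ _ _ _, hσ, if_true, if_false,
      Bool.false_eq_true, Finset.expect_add_distrib]
    refine add_le_add ?_ ?_
    · split_ifs
      · exact le_rfl
      refine le_trans (Finset.expect_le_expect fun i hi => mul_le_mul_of_nonneg_left ?_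
        (hq.nonneg i hi)) (expect_le_expect_of_sum_le (hq.sum_mul_mean_erase_le hρ))
      rw [← remaining_cons]
      exact hφ.continuationValue_le_mean hρ r (List.mem_cons_self ..)
    · have hmul {i} (hi : i ∈ remaining past) {x y : ℝ} (h : x ≤ y) :
          (1 - q i) * x ≤ (1 - q i) * y :=
        mul_le_mul_of_nonneg_left h (sub_nonneg.2 (hq.le_one hi))
      split_ifs
      · refine (expect_le_expect_of_sum_le hq.sum_one_sub_mul_le).trans
          (Finset.expect_le_expect fun i hi => hmul hi ?_)
        rw [← remaining_cons]
        exact hφ.mean_le_continuationValue hp hσ'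
      · exact Finset.expect_le_expect fun i hi => hmul hi (ih i hi hσ')

theorem Mechanism.FollowsLottery.persuasiveWithDisclosure (hφ : φ.FollowsLottery p)
    (hp : ∀ R : Finset (Fin n), R.Nonempty → IsFavorableLottery ρ R (p R))
    (hρ : ∀ i, 0 ≤ ρ i) : PersuasiveWithDisclosure ρ φ := by
  intro r
  simp only [expectedValue_eq_continuationValue]
  exact hφ.continuationValue_le_obedient hp hρ r List.not_mem_nil

end FavorableLotteries

section ParetoProcedure

variable {n : ℕ} {R : Finset (Fin n)} {ρ ξ : Fin n → ℝ} {c M : Fin n}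

/-- `M` is a receiver-optimal candidate of the set `R`. -/
def IsReceiverBest (R : Finset (Fin n)) (ρ : Fin n → ℝ) (M : Fin n) : Prop :=
  M ∈ R ∧ ∀ j ∈ R, ρ j ≤ ρ M

theorem exists_isReceiverBest (hR : R.Nonempty) (ρ : Fin n → ℝ) : ∃ M, IsReceiverBest R ρ M :=
  R.exists_max_image ρ hR

theorem exists_isSenderBest (hR : R.Nonempty) (ξ : Fin n → ℝ) : ∃ c, IsSenderBest R ξ c :=
  R.exists_max_image ξ hR

theorem IsReceiverBest.mean_le (hM : IsReceiverBest R ρ M) : mean R ρ ≤ ρ M := by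
  rw [mean_eq_expect]
  exact Finset.expect_le ⟨M, hM.1⟩ hM.2

theorem IsReceiverBest.mean_lt (hM : IsReceiverBest R ρ M) (hc : c ∈ R) (h : ρ c < ρ M) :
    mean R ρ < ρ M := by
  rw [mean, div_lt_iff₀ (Nat.cast_pos.2 (Finset.card_pos.2 ⟨c, hc⟩)), mul_comm, ← nsmul_eq_mul,
    ← Finset.sum_const]
  exact Finset.sum_lt_sum hM.2 ⟨c, hc, h⟩

theorem ordinalUtility_eq_single (hξ : Function.Injective ξ) (hc : IsSenderBest R ξ c) :
    ordinalUtility R ξ = Pi.single c 1 := by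
  have hiff (i) : IsSenderBest R ξ i ↔ i = c :=
    ⟨fun hi => hξ ((hc.2 i hi.1).antisymm (hi.2 c hc.1)), fun hi => hi ▸ hc⟩
  funext i
  simp only [ordinalUtility, hiff, Pi.single_apply]

theorem isSenderBest_single_iff (hc : c ∈ R) {a : Fin n} :
    IsSenderBest R (Pi.single c 1) a ↔ a = c := by
  constructor
  · intro h
    by_contra hne
    have := h.2 c hc
    rw [Pi.single_eq_same, Pi.single_eq_of_ne hne] at this
    exact not_le_of_gt one_pos this
  · rintro rfl
    refine ⟨hc, fun j _ => ?_⟩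
    rw [Pi.single_eq_same, Pi.single_apply]
    split_ifs
    · exact le_rfl
    · exact zero_le_one

theorem mem_paretoCurve_of_forall_le {x : ℝ × ℝ} {d : ℝ} (hd : 0 < d)
    (hx : x ∈ convexHull ℝ ((fun i => (ρ i, ξ i)) '' (R : Set (Fin n))))
    (hmax : ∀ i ∈ R, ρ i + d * ξ i ≤ x.1 + d * x.2) : x ∈ paretoCurve R ρ ξ := by
  let f : ℝ × ℝ →ₗ[ℝ] ℝ := .fst ℝ ℝ ℝ + d • .snd ℝ ℝ ℝ
  have hhull : convexHull ℝ ((fun i => (ρ i, ξ i)) '' (R : Set (Fin n))) ⊆ {y | f y ≤ f x} :=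
    convexHull_min (by rintro _ ⟨i, hi, rfl⟩; exact hmax i hi)
      (convex_halfSpace_le f.isLinear (f x))
  refine ⟨hx, fun y hy hxy => ?_⟩
  have hyx : y.1 + d * y.2 ≤ x.1 + d * x.2 := hhull hy
  have hsnd : d * x.2 ≤ d * y.2 := mul_le_mul_of_nonneg_left hxy.2 hd.le
  exact ⟨by linarith, le_of_mul_le_mul_left (by linarith [hxy.1]) hd⟩

theorem exists_mem_segment_fst_eq {x y : ℝ × ℝ} {m : ℝ} (hx : x.1 ≤ m) (hy : m ≤ y.1) :
    ∃ p ∈ segment ℝ x y, p.1 = m := by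
  have himage := image_segment ℝ (LinearMap.fst ℝ ℝ ℝ).toAffineMap x y
  have hm : m ∈ segment ℝ x.1 y.1 := segment_eq_Icc (hx.trans hy) ▸ ⟨hx, hy⟩
  exact himage.symm.subset hm

variable {u : Fin n → ℝ}

theorem segment_subset_paretoCurve (hu : u = Pi.single c 1) (hc : c ∈ R)
    (hM : IsReceiverBest R ρ M) (h : ρ c < ρ M) :
    segment ℝ (ρ c, u c) (ρ M, u M) ⊆ paretoCurve R ρ u := by
  have hMc : M ≠ c := fun heq => h.ne (congrArg ρ heq.symm)
  let f : ℝ × ℝ →ₗ[ℝ] ℝ := .fst ℝ ℝ ℝ + (ρ M - ρ c) • .snd ℝ ℝ ℝ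
  have hsegment : segment ℝ (ρ c, u c) (ρ M, u M) ⊆ {y | f y = ρ M} :=
    (convex_hyperplane f.isLinear (ρ M)).segment_subset (by simp [f, hu]) (by simp [f, hu, hMc])
  intro x hx
  refine mem_paretoCurve_of_forall_le (sub_pos.2 h) (segment_subset_convexHull
    (Set.mem_image_of_mem _ hc) (Set.mem_image_of_mem _ hM.1) hx) fun i hi => ?_
  have hfx : x.1 + (ρ M - ρ c) * x.2 = ρ M := hsegment hx
  rw [hfx, hu, Pi.single_apply]
  split_ifs with hic
  · simp [hic]
  · simpa using hM.2 i hi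

theorem eq_or_eq_of_mem_paretoCurve (hu : u = Pi.single c 1) (hρ : Function.Injective ρ)
    (hM : IsReceiverBest R ρ M) {a : Fin n} (ha : a ∈ R) (hmax : (ρ a, u a) ∈ paretoCurve R ρ u) :
    a = c ∨ a = M := by
  refine or_iff_not_imp_left.2 fun hac => hρ ((hM.2 a ha).antisymm ?_)
  have huM : u a ≤ u M := by
    rw [hu, Pi.single_eq_of_ne hac, Pi.single_apply]
    split_ifs
    · exact zero_le_one
    · exact le_rfl
  exact (hmax.2 (subset_convexHull ℝ _ (Set.mem_image_of_mem _ hM.1)) ⟨hM.2 a ha, huM⟩).1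

theorem isParetoPair_iff_of_lt_mean (hu : u = Pi.single c 1) (hρ : Function.Injective ρ)
    (hc : c ∈ R) (hM : IsReceiverBest R ρ M) (h : ρ c < mean R ρ) {a b : Fin n} :
    IsParetoPair R ρ u a b ↔ a = c ∧ b = M ∨ a = M ∧ b = c := by
  have hlt : ρ c < ρ M := h.trans_le hM.mean_le
  have hbest (a) (ha : IsSenderBest R u a) : ρ a < mean R ρ :=
    (isSenderBest_single_iff hc).1 (hu ▸ ha) ▸ h
  have hsegment := segment_subset_paretoCurve hu hc hM hlt
  have hmeet := exists_mem_segment_fst_eq (x := (ρ c, u c)) (y := (ρ M, u M)) h.le hM.mean_le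
  constructor
  · rintro (⟨ha, hle, -⟩ | ⟨-, ha, hb, hab, x, hx, hxm⟩)
    · exact absurd (hbest a ha) hle.not_gt
    · have hne : a = b → ρ a = mean R ρ := by
        rintro rfl
        rw [segment_same, Set.mem_singleton_iff] at hx
        rw [← hxm, hx]
      rcases eq_or_eq_of_mem_paretoCurve hu hρ hM ha (hab (left_mem_segment ℝ _ _)) with
        rfl | rfl <;>
      rcases eq_or_eq_of_mem_paretoCurve hu hρ hM hb (hab (right_mem_segment ℝ _ _)) with
        rfl | rfl
      · exact absurd (hne rfl) h.ne
      · exact Or.inl ⟨rfl, rfl⟩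
      · exact Or.inr ⟨rfl, rfl⟩
      · exact absurd (hne rfl) (hM.mean_lt hc hlt).ne'
  · rintro (⟨rfl, rfl⟩ | ⟨rfl, rfl⟩)
    · exact Or.inr ⟨hbest, hc, hM.1, hsegment, hmeet⟩
    · rw [segment_symm] at hsegment hmeet
      exact Or.inr ⟨hbest, hM.1, hc, hsegment, hmeet⟩

theorem isParetoPair_iff_of_mean_le (hu : u = Pi.single c 1) (hc : c ∈ R) (h : mean R ρ ≤ ρ c)
    {a b : Fin n} : IsParetoPair R ρ u a b ↔ a = c ∧ b = c := by
  subst hu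
  constructor
  · rintro (⟨ha, -, hab⟩ | ⟨hbest, -⟩)
    · have hac := (isSenderBest_single_iff hc).1 ha
      exact ⟨hac, hab.trans hac⟩
    · exact absurd (hbest c ((isSenderBest_single_iff hc).2 rfl)) h.not_gt
  · rintro ⟨rfl, rfl⟩
    exact Or.inl ⟨(isSenderBest_single_iff hc).2 rfl, h, rfl⟩

theorem paretoLottery_eq {p : Fin n → ℝ} (hex : ∃ a b, IsParetoPair R ρ ξ a b)
    (hp : ∀ a b, IsParetoPair R ρ ξ a b →
      Pi.single a (max 0 (min 1 (paretoAlpha R ρ ξ a b))) +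
        Pi.single b (1 - max 0 (min 1 (paretoAlpha R ρ ξ a b))) = p) :
    paretoLottery R ρ ξ = p := by
  have hpair : ∃ x : Fin n × Fin n, IsParetoPair R ρ ξ x.1 x.2 :=
    let ⟨a, b, h⟩ := hex
    ⟨(a, b), h⟩
  rw [← hp _ _ hpair.choose_spec]
  funext i
  simp only [paretoLottery, dif_pos hpair, Pi.add_apply, Pi.single_apply]

/-- The probability that the Pareto procedure on `R` returns the sender-optimal candidate `c`, where
`M` is the receiver-optimal one. -/
noncomputable def senderProb (R : Finset (Fin n)) (ρ : Fin n → ℝ) (c M : Fin n) : ℝ :=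
  if mean R ρ ≤ ρ c then 1 else (ρ M - mean R ρ) / (ρ M - ρ c)

theorem senderProb_nonneg (hc : c ∈ R) (hM : IsReceiverBest R ρ M) : 0 ≤ senderProb R ρ c M := by
  rw [senderProb]
  split_ifs
  · exact zero_le_one
  · exact div_nonneg (sub_nonneg.2 hM.mean_le) (sub_nonneg.2 (hM.2 c hc))

theorem senderProb_le_one (hc : c ∈ R) (hM : IsReceiverBest R ρ M) : senderProb R ρ c M ≤ 1 := by
  rw [senderProb]
  split_ifs with h
  · exact le_rfl
  · exact div_le_one_of_le₀ (by linarith) (sub_nonneg.2 (hM.2 c hc))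

theorem paretoLottery_of_mean_le (hu : u = Pi.single c 1) (hc : c ∈ R) (h : mean R ρ ≤ ρ c) :
    paretoLottery R ρ u = Pi.single c 1 := by
  have hiff {a b} := isParetoPair_iff_of_mean_le (a := a) (b := b) hu hc h
  refine paretoLottery_eq ⟨c, c, hiff.2 ⟨rfl, rfl⟩⟩ fun a b hab => ?_
  obtain ⟨rfl, rfl⟩ := hiff.1 hab
  rw [← Pi.single_add, add_sub_cancel]

theorem paretoLottery_of_lt_mean (hu : u = Pi.single c 1) (hρ : Function.Injective ρ)
    (hc : c ∈ R) (hM : IsReceiverBest R ρ M) (h : ρ c < mean R ρ) :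
    paretoLottery R ρ u =
      Pi.single c (senderProb R ρ c M) + Pi.single M (1 - senderProb R ρ c M) := by
  have hlt : ρ c < ρ M := h.trans_le hM.mean_le
  have hMc : M ≠ c := fun heq => hlt.ne (congrArg ρ heq.symm)
  have huM : u M ≠ u c := by simp [hu, hMc]
  have hq : senderProb R ρ c M = (ρ M - mean R ρ) / (ρ M - ρ c) := if_neg h.not_ge
  have hq0 := senderProb_nonneg hc hM
  have hq1 := senderProb_le_one hc hM
  have hiff {a b} := isParetoPair_iff_of_lt_mean (a := a) (b := b) hu hρ hc hM h
  refine paretoLottery_eq ⟨c, M, hiff.2 (Or.inl ⟨rfl, rfl⟩)⟩ fun a b hab => ?_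
  rcases hiff.1 hab with ⟨rfl, rfl⟩ | ⟨rfl, rfl⟩
  · have hα : paretoAlpha R ρ u a b = senderProb R ρ a b := by
      rw [paretoAlpha, if_neg hlt.ne, if_neg huM.symm, hq, ← neg_div_neg_eq, neg_sub, neg_sub]
    rw [hα, min_eq_right hq1, max_eq_right hq0]
  · have hα : paretoAlpha R ρ u a b = 1 - senderProb R ρ b a := by
      rw [paretoAlpha, if_neg hlt.ne', if_neg huM, hq, one_sub_div (sub_pos.2 hlt).ne',
        sub_sub_sub_cancel_left]
    rw [hα, min_eq_right (sub_le_self _ hq0), max_eq_right (sub_nonneg.2 hq1), sub_sub_cancel,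
      add_comm]

theorem mean_div (R : Finset (Fin n)) (ρ : Fin n → ℝ) (s : ℝ) :
    mean R (fun i => ρ i / s) = mean R ρ / s := by
  rw [mean, mean, ← Finset.sum_div, div_right_comm]

theorem senderProb_div (R : Finset (Fin n)) (ρ : Fin n → ℝ) (c M : Fin n) {s : ℝ} (hs : 0 < s) :
    senderProb R (fun i => ρ i / s) c M = senderProb R ρ c M := by
  simp only [senderProb, mean_div, div_le_div_iff_of_pos_right hs, ← sub_div,
    div_div_div_cancel_right₀ hs.ne']

theorem ordinalParetoLottery_eq (h : IsInstance ρ ξ) (hc : IsSenderBest R ξ c)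
    (hM : IsReceiverBest R ρ M) :
    ordinalParetoLottery ρ ξ R =
      Pi.single c (senderProb R ρ c M) + Pi.single M (1 - senderProb R ρ c M) := by
  have hu := ordinalUtility_eq_single h.xi_injective hc
  have hsup : sSup (ρ '' (R : Set (Fin n))) = ρ M :=
    IsGreatest.csSup_eq ⟨Set.mem_image_of_mem ρ hM.1, Set.forall_mem_image.2 hM.2⟩
  rw [ordinalParetoLottery, hsup]
  rcases le_or_gt (mean R ρ) (ρ c) with hle | hlt
  · rw [paretoLottery_of_mean_le hu hc.1, senderProb, if_pos hle, sub_self, Pi.single_zero,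
      add_zero]
    exact mean_div R ρ (ρ M) ▸ div_le_div_of_nonneg_right hle (h.rho_nonneg M)
  · have hs : 0 < ρ M := (h.rho_nonneg c).trans_lt (hlt.trans_le hM.mean_le)
    rw [← senderProb_div R ρ c M hs]
    refine paretoLottery_of_lt_mean hu (fun a b hab => h.rho_injective ?_) hc.1
      ⟨hM.1, fun j hj => div_le_div_of_nonneg_right (hM.2 j hj) hs.le⟩
      (mean_div R ρ (ρ M) ▸ div_lt_div_of_pos_right hlt hs)
    exact (div_left_inj' hs.ne').1 hab

theorem sum_single_add_single_mul (hc : c ∈ R) (hM : M ∈ R) (x y : ℝ) (w : Fin n → ℝ) :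
    ∑ i ∈ R, (Pi.single c x + Pi.single M y : Fin n → ℝ) i * w i = x * w c + y * w M := by
  simp [Pi.single_apply, add_mul, Finset.sum_add_distrib, hc, hM]

theorem isFavorableLottery_single_add_single (hc : c ∈ R) (hM : IsReceiverBest R ρ M) :
    IsFavorableLottery ρ R
      (Pi.single c (senderProb R ρ c M) + Pi.single M (1 - senderProb R ρ c M)) where
  nonneg i _ := by
    have hsingle (j : Fin n) {q : ℝ} (hq : 0 ≤ q) : 0 ≤ (Pi.single j q : Fin n → ℝ) i :=
      (Pi.single_nonneg.2 hq : (0 : Fin n → ℝ) ≤ Pi.single j q) i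
    exact add_nonneg (hsingle c (senderProb_nonneg hc hM))
      (hsingle M (sub_nonneg.2 (senderProb_le_one hc hM)))
  sum_eq_one := by
    simpa using sum_single_add_single_mul hc hM.1 (senderProb R ρ c M) (1 - senderProb R ρ c M) 1
  mean_le := by
    rw [sum_single_add_single_mul hc hM.1, senderProb]
    split_ifs with h
    · simpa using h
    · have hd : ρ M - ρ c ≠ 0 := (sub_pos.2 ((not_le.1 h).trans_le hM.mean_le)).ne'
      apply le_of_eq
      field_simp
      ring

theorem isFavorableLottery_ordinalParetoLottery (h : IsInstance ρ ξ) (hR : R.Nonempty) :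
    IsFavorableLottery ρ R (ordinalParetoLottery ρ ξ R) := by
  obtain ⟨c, hc⟩ := exists_isSenderBest hR ξ
  obtain ⟨M, hM⟩ := exists_isReceiverBest hR ρ
  exact ordinalParetoLottery_eq h hc hM ▸ isFavorableLottery_single_add_single hc.1 hM

theorem followsLottery_shrinkingPareto (ρ ξ : Fin n → ℝ) :
    (shrinkingPareto ρ ξ).FollowsLottery (ordinalParetoLottery ρ ξ) :=
  fun _ _ _ => rfl

theorem persuasiveWithDisclosure_shrinkingPareto (h : IsInstance ρ ξ) :
    PersuasiveWithDisclosure ρ (shrinkingPareto ρ ξ) :=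
  (followsLottery_shrinkingPareto ρ ξ).persuasiveWithDisclosure
    (fun _ => isFavorableLottery_ordinalParetoLottery h) h.rho_nonneg

end ParetoProcedure

section SuccessProbability

variable {n : ℕ} {R : Finset (Fin n)} {ρ ξ : Fin n → ℝ} {c M : Fin n}

theorem IsSenderBest.erase (hc : IsSenderBest R ξ c) {i : Fin n} (hi : i ≠ c) :
    IsSenderBest (R.erase i) ξ c :=
  ⟨Finset.mem_erase.2 ⟨hi.symm, hc.1⟩, fun j hj => hc.2 j (Finset.mem_of_mem_erase hj)⟩

theorem IsReceiverBest.erase (hM : IsReceiverBest R ρ M) {i : Fin n} (hi : i ≠ M) :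
    IsReceiverBest (R.erase i) ρ M :=
  ⟨Finset.mem_erase.2 ⟨hi.symm, hM.1⟩, fun j hj => hM.2 j (Finset.mem_of_mem_erase hj)⟩

theorem senderProb_self (hM : IsReceiverBest R ρ M) : senderProb R ρ M M = 1 :=
  if_pos hM.mean_le

theorem ordinalParetoLottery_senderBest (h : IsInstance ρ ξ) (hc : IsSenderBest R ξ c)
    (hM : IsReceiverBest R ρ M) : ordinalParetoLottery ρ ξ R c = senderProb R ρ c M := by
  rw [ordinalParetoLottery_eq h hc hM]
  rcases eq_or_ne c M with rfl | hne
  · simp [senderProb_self hM]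
  · simp [hne]

theorem sum_sub_eq_card_mul (R : Finset (Fin n)) (ρ : Fin n → ℝ) (M : Fin n) :
    ∑ i ∈ R, (ρ M - ρ i) = R.card * (ρ M - mean R ρ) := by
  rw [Finset.sum_sub_distrib, Finset.sum_const, nsmul_eq_mul, mul_sub, card_mul_mean]

theorem mean_le_iff_mul_le_sum (hR : R.Nonempty) :
    mean R ρ ≤ ρ c ↔ R.card * (ρ M - ρ c) ≤ ∑ i ∈ R, (ρ M - ρ i) := by
  rw [sum_sub_eq_card_mul, mul_le_mul_iff_of_pos_left (Nat.cast_pos.2 hR.card_pos),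
    sub_le_sub_iff_left]

theorem senderProb_eq_min (hc : c ∈ R) (h : ρ c < ρ M) :
    senderProb R ρ c M = min 1 ((∑ i ∈ R, (ρ M - ρ i)) / (R.card * (ρ M - ρ c))) := by
  have hcard : (0 : ℝ) < R.card := Nat.cast_pos.2 (Finset.card_pos.2 ⟨c, hc⟩)
  rw [sum_sub_eq_card_mul, mul_div_mul_left _ _ hcard.ne', senderProb]
  split_ifs with hle
  · rw [min_eq_left ((one_le_div (sub_pos.2 h)).2 (by linarith))]
  · rw [min_eq_right ((div_le_one (sub_pos.2 h)).2 (by linarith))]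

theorem senderProb_erase_eq_min (hc : c ∈ R) (h : ρ c < ρ M) {i : Fin n} (hi : i ∈ R)
    (hic : i ≠ c) : senderProb (R.erase i) ρ c M =
      min 1 ((∑ j ∈ R, (ρ M - ρ j) - (ρ M - ρ i)) / ((R.card - 1) * (ρ M - ρ c))) := by
  rw [senderProb_eq_min (Finset.mem_erase.2 ⟨hic.symm, hc⟩) h, Finset.cast_card_erase_of_mem hi,
    Finset.sum_erase_eq_sub hi]

theorem sum_erase_erase (hc : c ∈ R) (hM : M ∈ R) (hMc : M ≠ c) (f : Fin n → ℝ) :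
    ∑ i ∈ (R.erase c).erase M, f i = ∑ i ∈ R, f i - f c - f M := by
  rw [Finset.sum_erase_eq_sub (Finset.mem_erase.2 ⟨hMc, hM⟩), Finset.sum_erase_eq_sub hc]

theorem le_sum_senderProb_erase_of_le (hc : c ∈ R) (hM : IsReceiverBest R ρ M) (h : ρ c < ρ M)
    (hT : (R.card - 1) * (ρ M - ρ c) ≤ ∑ i ∈ R, (ρ M - ρ i)) :
    (R.card - 3 : ℝ) ≤ ∑ i ∈ (R.erase c).erase M, senderProb (R.erase i) ρ c M := by
  have hMc : M ≠ c := fun heq => h.ne (congrArg ρ heq.symm)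
  set T := ∑ i ∈ R, (ρ M - ρ i)
  have hd (i) (hi : i ∈ R) : 0 ≤ ρ M - ρ i := sub_nonneg.2 (hM.2 i hi)
  have hdT (i) (hi : i ∈ R) : ρ M - ρ i ≤ T :=
    Finset.single_le_sum (f := fun i => ρ M - ρ i) hd hi
  have hTpos : 0 < T := (sub_pos.2 h).trans_le (hdT c hc)
  have hcard : (1 : ℝ) < R.card := Nat.one_lt_cast.2 (Finset.one_lt_card.2 ⟨M, hM.1, c, hc, hMc⟩)
  calc (R.card - 3 : ℝ) ≤ R.card - 2 - (T - (ρ M - ρ c)) / T := by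
        have : (T - (ρ M - ρ c)) / T ≤ 1 := (div_le_one hTpos).2 (by linarith)
        linarith
    _ = ∑ i ∈ (R.erase c).erase M, (1 - (ρ M - ρ i) / T) := by
        rw [sum_erase_erase hc hM.1 hMc, Finset.sum_sub_distrib, ← Finset.sum_div,
          Finset.sum_const, nsmul_one, sub_self, zero_div]
        ring
    _ ≤ _ := by
        refine Finset.sum_le_sum fun i hi => ?_
        obtain ⟨-, hic, hiR⟩ := by simpa only [Finset.mem_erase] using hi
        rw [senderProb_erase_eq_min hc h hiR hic]
        refine le_min (sub_le_self _ (div_nonneg (hd i hiR) hTpos.le)) ?_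
        rw [one_sub_div hTpos.ne']
        exact div_le_div_of_nonneg_left (sub_nonneg.2 (hdT i hiR))
          (mul_pos (sub_pos.2 hcard) (sub_pos.2 h)) hT

theorem senderProb_mul_le_sum_of_lt (hc : c ∈ R) (hM : IsReceiverBest R ρ M) (h : ρ c < ρ M)
    (hT : ∑ i ∈ R, (ρ M - ρ i) < (R.card - 1) * (ρ M - ρ c)) :
    senderProb R ρ c M * ((R.card - 3) * (R.card - 1)) ≤
      (∑ i ∈ (R.erase c).erase M, senderProb (R.erase i) ρ c M) * (R.card - 2) := by
  have hMc : M ≠ c := fun heq => h.ne (congrArg ρ heq.symm)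
  have hD : 0 < ρ M - ρ c := sub_pos.2 h
  set T := ∑ i ∈ R, (ρ M - ρ i)
  have hd (i) (hi : i ∈ R) : 0 ≤ ρ M - ρ i := sub_nonneg.2 (hM.2 i hi)
  have hT0 : 0 ≤ T := Finset.sum_nonneg hd
  have hcard : (2 : ℝ) ≤ R.card :=
    Nat.ofNat_le_cast.2 (Finset.one_lt_card.2 ⟨M, hM.1, c, hc, hMc⟩)
  have hk : 0 < (R.card - 1 : ℝ) := by linarith
  have hP : senderProb R ρ c M = T / (R.card * (ρ M - ρ c)) := by
    rw [senderProb_eq_min hc h, min_eq_right]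
    exact (div_le_one (by positivity)).2 (by linarith)
  have hX : ∑ i ∈ (R.erase c).erase M, senderProb (R.erase i) ρ c M =
      ((R.card - 3) * T + (ρ M - ρ c)) / ((R.card - 1) * (ρ M - ρ c)) := by
    calc _ = ∑ i ∈ (R.erase c).erase M, (T - (ρ M - ρ i)) / ((R.card - 1) * (ρ M - ρ c)) := by
          refine Finset.sum_congr rfl fun i hi => ?_
          obtain ⟨-, hic, hiR⟩ := by simpa only [Finset.mem_erase] using hi
          rw [senderProb_erase_eq_min hc h hiR hic, min_eq_right]
          exact (div_le_one (mul_pos hk hD)).2 (by linarith [hd i hiR])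
      _ = _ := by
          rw [← Finset.sum_div, sum_erase_erase hc hM.1 hMc, Finset.sum_sub_distrib,
            Finset.sum_const, nsmul_eq_mul]
          ring
  have hkey : (R.card - 3) * T ≤ R.card * (R.card - 2) * (ρ M - ρ c) := by
    rcases le_total (R.card : ℝ) 3 with h3 | h3
    · exact (mul_nonpos_of_nonpos_of_nonneg (sub_nonpos.2 h3) hT0).trans
        (mul_nonneg (mul_nonneg (Nat.cast_nonneg _) (sub_nonneg.2 hcard)) hD.le)
    · nlinarith
  rw [hP, hX, div_mul_eq_mul_div, div_mul_eq_mul_div,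
    div_le_div_iff₀ (by positivity) (by positivity)]
  have := mul_le_mul_of_nonneg_right hkey hD.le
  linear_combination this

theorem sum_one_sub_ordinalParetoLottery_mul_erase (h : IsInstance ρ ξ) (hc : IsSenderBest R ξ c)
    (hM : IsReceiverBest R ρ M) (hMc : M ≠ c) :
    ∑ i ∈ R.erase c, (1 - ordinalParetoLottery ρ ξ R i) * ordinalParetoLottery ρ ξ (R.erase i) c =
      senderProb R ρ c M * ordinalParetoLottery ρ ξ (R.erase M) c +
        ∑ i ∈ (R.erase c).erase M, senderProb (R.erase i) ρ c M := by
  rw [← Finset.add_sum_erase _ _ (Finset.mem_erase.2 ⟨hMc, hM.1⟩), ordinalParetoLottery_eq h hc hM]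
  congr 1
  · simp [hMc]
  · refine Finset.sum_congr rfl fun i hi => ?_
    obtain ⟨hiM, hic, -⟩ := by simpa only [Finset.mem_erase] using hi
    rw [ordinalParetoLottery_senderBest h (hc.erase hic) (hM.erase hiM)]
    simp [hic, hiM]

theorem ordinalParetoLottery_mul_le_sum_of_isReceiverBest (h : IsInstance ρ ξ)
    (hc : IsSenderBest R ξ c) (hM : IsReceiverBest R ρ c) :
    ordinalParetoLottery ρ ξ R c * ((R.card - 3) * (R.card - 1)) ≤
      (∑ i ∈ R.erase c, (1 - ordinalParetoLottery ρ ξ R i) *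
        ordinalParetoLottery ρ ξ (R.erase i) c) * (R.card - 2) := by
  have hX : ∑ i ∈ R.erase c, (1 - ordinalParetoLottery ρ ξ R i) *
      ordinalParetoLottery ρ ξ (R.erase i) c = R.card - 1 := by
    rw [← Finset.cast_card_erase_of_mem hc.1, Finset.cast_card]
    refine Finset.sum_congr rfl fun i hi => ?_
    have hic := Finset.ne_of_mem_erase hi
    rw [ordinalParetoLottery_senderBest h (hc.erase hic) (hM.erase hic),
      senderProb_self (hM.erase hic), ordinalParetoLottery_eq h hc hM]
    simp [hic]
  have hcard : (1 : ℝ) ≤ R.card := Nat.one_le_cast.2 (Finset.card_pos.2 ⟨c, hc.1⟩)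
  rw [hX, ordinalParetoLottery_senderBest h hc hM, senderProb_self hM, one_mul, mul_comm]
  exact mul_le_mul_of_nonneg_left (by linarith) (sub_nonneg.2 hcard)

theorem ordinalParetoLottery_mul_le_sum_of_ne (h : IsInstance ρ ξ) (hc : IsSenderBest R ξ c)
    (hM : IsReceiverBest R ρ M) (hMc : M ≠ c) :
    ordinalParetoLottery ρ ξ R c * ((R.card - 3) * (R.card - 1)) ≤
      (∑ i ∈ R.erase c, (1 - ordinalParetoLottery ρ ξ R i) *
        ordinalParetoLottery ρ ξ (R.erase i) c) * (R.card - 2) := by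
  have hlt : ρ c < ρ M := lt_of_le_of_ne (hM.2 c hc.1) (h.rho_injective.ne hMc.symm)
  have hcM : IsSenderBest (R.erase M) ξ c := hc.erase hMc
  obtain ⟨M', hM'⟩ := exists_isReceiverBest ⟨c, hcM.1⟩ ρ
  have hcard : 2 ≤ R.card := Finset.one_lt_card.2 ⟨M, hM.1, c, hc.1, hMc⟩
  have hcard' : (2 : ℝ) ≤ R.card := Nat.ofNat_le_cast.2 hcard
  have hq0 := senderProb_nonneg hc.1 hM
  rw [sum_one_sub_ordinalParetoLottery_mul_erase h hc hM hMc,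
    ordinalParetoLottery_senderBest h hc hM, ordinalParetoLottery_senderBest h hcM hM']
  rcases le_or_gt ((R.card - 1) * (ρ M - ρ c)) (∑ i ∈ R, (ρ M - ρ i)) with hT | hT
  · have hone : senderProb (R.erase M) ρ c M' = 1 := by
      refine if_pos ((mean_le_iff_mul_le_sum (M := M) ⟨c, hcM.1⟩).2 ?_)
      rwa [Finset.cast_card_erase_of_mem hM.1, Finset.sum_erase_eq_sub hM.1, sub_self, sub_zero]
    have hS := le_sum_senderProb_erase_of_le hc.1 hM hlt hT
    have hprod : 0 ≤ (R.card - 3 : ℝ) * (R.card - 2) := by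
      rcases hcard.eq_or_lt with h2 | h3
      · norm_num [← h2]
      · have : (3 : ℝ) ≤ R.card := Nat.ofNat_le_cast.2 h3
        exact mul_nonneg (by linarith) (by linarith)
    rw [hone]
    nlinarith [mul_nonneg (sub_nonneg.2 (senderProb_le_one hc.1 hM)) hprod]
  · refine (senderProb_mul_le_sum_of_lt hc.1 hM hlt hT).trans
      (mul_le_mul_of_nonneg_right ?_ (sub_nonneg.2 hcard'))
    exact le_add_of_nonneg_left (mul_nonneg hq0 (senderProb_nonneg hcM.1 hM'))

theorem ordinalParetoLottery_mul_le_sum (h : IsInstance ρ ξ) (hc : IsSenderBest R ξ c) :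
    ordinalParetoLottery ρ ξ R c * ((R.card - 3) * (R.card - 1)) ≤
      (∑ i ∈ R.erase c, (1 - ordinalParetoLottery ρ ξ R i) *
        ordinalParetoLottery ρ ξ (R.erase i) c) * (R.card - 2) := by
  obtain ⟨M, hM⟩ := exists_isReceiverBest ⟨c, hc.1⟩ ρ
  rcases eq_or_ne M c with rfl | hMc
  · exact ordinalParetoLottery_mul_le_sum_of_isReceiverBest h hc hM
  · exact ordinalParetoLottery_mul_le_sum_of_ne h hc hM hMc

theorem ordinalParetoLottery_mul_card_le_add (h : IsInstance ρ ξ) (hc : IsSenderBest R ξ c)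
    (hR : 1 < R.card) :
    ordinalParetoLottery ρ ξ R c * (1 / 2 - 1 / (2 * R.card)) * R.card ≤
      ordinalParetoLottery ρ ξ R c + (∑ i ∈ R.erase c, (1 - ordinalParetoLottery ρ ξ R i) *
        ordinalParetoLottery ρ ξ (R.erase i) c) * (1 / 2 - 1 / (2 * (R.card - 1))) := by
  have hcard : (0 : ℝ) < R.card - 1 := sub_pos.2 (Nat.one_lt_cast.2 hR)
  have : (0 : ℝ) < R.card := by linarith
  rw [show (1 / 2 - 1 / (2 * (R.card - 1)) : ℝ) = (R.card - 2) / (2 * (R.card - 1)) by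
      field_simp; ring, show ordinalParetoLottery ρ ξ R c * (1 / 2 - 1 / (2 * R.card)) * R.card =
        ordinalParetoLottery ρ ξ R c * (R.card - 1) / 2 by field_simp,
    ← mul_div_assoc, ← sub_le_iff_le_add', le_div_iff₀ (by positivity)]
  linarith [ordinalParetoLottery_mul_le_sum h hc]

theorem ordinalParetoLottery_mul_le_continuationValue (h : IsInstance ρ ξ) {past : List (Fin n)}
    {σ : List Bool} (hc : IsSenderBest (remaining past) ξ c) (hσ : true ∉ σ) :
    ordinalParetoLottery ρ ξ (remaining past) c * (1 / 2 - 1 / (2 * (remaining past).card)) ≤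
      continuationValue (shrinkingPareto ρ ξ) obedient (Pi.single c 1) past σ := by
  induction past using arrival_induction generalizing σ with
  | step past ih =>
    have hp := isFavorableLottery_ordinalParetoLottery h ⟨c, hc.1⟩
    have hcv := continuationValue_nonneg (shrinkingPareto ρ ξ) obedient
      (Pi.single_nonneg.2 (zero_le_one' ℝ) : 0 ≤ Pi.single c 1)
    rcases (Finset.one_le_card.2 ⟨c, hc.1⟩).eq_or_lt with h1 | h1
    · exact le_trans (by norm_num [← h1]) (hcv _ _)
    have hchild (i) (hi : i ∈ (remaining past).erase c) :
        ordinalParetoLottery ρ ξ ((remaining past).erase i) c *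
            (1 / 2 - 1 / (2 * ((remaining past).card - 1))) ≤
          continuationValue (shrinkingPareto ρ ξ) obedient (Pi.single c 1) (i :: past)
            (false :: σ) := by
      obtain ⟨hic, hiR⟩ := Finset.mem_erase.1 hi
      rw [← Finset.cast_card_erase_of_mem hiR, ← remaining_cons]
      exact ih i hiR (by rw [remaining_cons]; exact hc.erase hic) (by simpa using hσ)
    rw [(followsLottery_shrinkingPareto ρ ξ).continuationValue_obedient_eq _ hσ,
      Finset.expect_eq_sum_div_card, le_div_iff₀ (Nat.cast_pos.2 (Finset.card_pos.2 ⟨c, hc.1⟩)),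
      ← Finset.add_sum_erase _ _ hc.1, Pi.single_eq_same, mul_one]
    refine (ordinalParetoLottery_mul_card_le_add h hc h1).trans ?_
    rw [Finset.sum_mul]
    refine add_le_add (le_add_of_nonneg_right
      (mul_nonneg (sub_nonneg.2 (hp.le_one hc.1)) (hcv _ _))) (Finset.sum_le_sum fun i hi => ?_)
    obtain ⟨hic, hiR⟩ := Finset.mem_erase.1 hi
    rw [Pi.single_eq_of_ne hic, mul_zero, zero_add, mul_assoc]
    exact mul_le_mul_of_nonneg_left (hchild i hi) (sub_nonneg.2 (hp.le_one hiR))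

theorem ordinalParetoLottery_mul_le_successProb (h : IsInstance ρ ξ)
    (hc : IsSenderBest Finset.univ ξ c) :
    ordinalParetoLottery ρ ξ Finset.univ c * (1 / 2 - 1 / (2 * n)) ≤
      successProb ξ (shrinkingPareto ρ ξ) := by
  have := ordinalParetoLottery_mul_le_continuationValue h (past := []) (σ := [])
    (by rwa [remaining_nil]) List.not_mem_nil
  rwa [remaining_nil, Finset.card_univ, Fintype.card_fin, ← expectedValue_eq_continuationValue,
    ← ordinalUtility_eq_single h.xi_injective hc] at this

end SuccessProbability

section Announcements

variable {n : ℕ}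

theorem expectedValue_eq_sum (φ : Mechanism n) (r : Strategy n) (v : Fin n → ℝ) :
    expectedValue φ r v = ∑ i, v i * expectedValue φ r (Pi.single i 1) := by
  have hsingle (i : Fin n) : (Pi.single i 1 : Fin n → ℝ) = fun j => if i = j then 1 else 0 := by
    funext j
    simp only [Pi.single_apply, eq_comm]
  simp only [hsingle]
  exact ((isLinearMap_expectedValue φ r).mk' _).pi_apply_eq_sum_univ v

theorem successProb_le_one (ξ : Fin n → ℝ) (φ : Mechanism n) : successProb ξ φ ≤ 1 :=
  expectedValue_le_of_forall_le φ obedient zero_le_one fun i => by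
    rw [ordinalUtility]
    split_ifs
    exacts [le_rfl, zero_le_one]

/-- The mechanism that signals HIRE exactly when `x` arrives. -/
def announce (x : Fin n) : Mechanism n where
  hireProb θ _ := if θ.head? = some x then 1 else 0
  hireProb_nonneg _ _ := by split_ifs <;> norm_num
  hireProb_le_one _ _ := by split_ifs <;> norm_num

/-- The mechanism that draws a candidate with probabilities proportional to the weights `p` in
advance and signals HIRE exactly when this candidate arrives. Its hiring probabilities are those
conditional on the drawn candidate not being in `past`; the quotient is `0` if all remaining weights
vanish. -/
noncomputable def announceRandom (p : Fin n → ℝ) (hp : ∀ i, 0 ≤ p i) : Mechanism n where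
  hireProb
    | [], _ => 0
    | i :: past, σ =>
        if true ∉ σ ∧ i ∈ remaining past then p i / ∑ j ∈ remaining past, p j else 0
  hireProb_nonneg θ σ := by
    cases θ with
    | nil => exact le_rfl
    | cons i past =>
      dsimp only
      split_ifs
      · exact div_nonneg (hp i) (Finset.sum_nonneg fun j _ => hp j)
      · exact le_rfl
  hireProb_le_one θ σ := by
    cases θ with
    | nil => exact zero_le_one
    | cons i past =>
      dsimp only
      split_ifs with h
      · exact div_le_one_of_le₀ (Finset.single_le_sum (fun j _ => hp j) h.2)
          (Finset.sum_nonneg fun j _ => hp j)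
      · exact zero_le_one

theorem announce_signalProb (x i : Fin n) (past : List (Fin n)) (σ : List Bool) (s : Bool) :
    (announce x).signalProb (i :: past) σ s = if s = decide (i = x) then 1 else 0 := by
  by_cases hix : i = x <;> cases s <;> simp [Mechanism.signalProb, announce, hix]

theorem continuationValue_announce (x : Fin n) (r : Strategy n) (v : Fin n → ℝ)
    (past : List (Fin n)) (σ : List Bool) :
    continuationValue (announce x) r v past σ = 𝔼 i ∈ remaining past,
      if r past (decide (i = x) :: σ) then v i
      else continuationValue (announce x) r v (i :: past) (decide (i = x) :: σ) := by
  rw [continuationValue_eq_expect]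
  simp only [announce_signalProb, ite_mul, one_mul, zero_mul, Finset.sum_ite_eq', Finset.mem_univ,
    if_true]

theorem expectedValue_announce_obedient (x : Fin n) (v : Fin n → ℝ) :
    expectedValue (announce x) obedient v = v x := by
  suffices ∀ (past : List (Fin n)) (σ : List Bool), x ∈ remaining past →
      continuationValue (announce x) obedient v past σ = v x by
    rw [expectedValue_eq_continuationValue]
    exact this [] [] (by simp [remaining_nil])
  intro past
  induction past using arrival_induction with
  | step past ih =>
    intro σ hx
    rw [continuationValue_announce, ← Finset.expect_const ⟨x, hx⟩ (v x)]
    refine Finset.expect_congr rfl fun i hi => ?_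
    by_cases hix : i = x
    · simp [hix, obedient]
    · have hx' : x ∈ remaining (i :: past) := by
        rw [remaining_cons]
        exact Finset.mem_erase.2 ⟨Ne.symm hix, hx⟩
      simp [hix, obedient, ih i hi _ hx']

section RandomAnnouncement

variable {p : Fin n → ℝ} (hp : ∀ i, 0 ≤ p i) {past : List (Fin n)} {σ : List Bool}

theorem announceRandom_hireProb {i : Fin n} (hi : i ∈ remaining past) :
    (announceRandom p hp).hireProb (i :: past) σ =
      if true ∈ σ then 0 else p i / ∑ j ∈ remaining past, p j := by
  by_cases hσ : true ∈ σ <;> simp [announceRandom, hσ, hi]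

variable (r : Strategy n) (v : Fin n → ℝ)

theorem continuationValue_announceRandom_of_mem (hσ : true ∈ σ) {x : Fin n}
    (hx : x ∉ remaining past) :
    continuationValue (announceRandom p hp) r v past σ =
      continuationValue (announce x) r v past σ := by
  induction past using arrival_induction generalizing σ with
  | step past ih =>
    rw [continuationValue_eq_expect, continuationValue_announce]
    refine Finset.expect_congr rfl fun i hi => ?_
    have hix : i ≠ x := fun h => hx (h ▸ hi)
    have hx' : x ∉ remaining (i :: past) := by
      rw [remaining_cons]
      exact fun h => hx (Finset.mem_of_mem_erase h)
    simp [Mechanism.signalProb, announceRandom_hireProb hp hi, hσ, hix,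
      ih i hi (List.mem_cons_of_mem false hσ) hx']

theorem sum_mul_continuationValue_announceRandom (hσ : true ∉ σ) :
    (∑ x ∈ remaining past, p x) * continuationValue (announceRandom p hp) r v past σ =
      ∑ x ∈ remaining past, p x * continuationValue (announce x) r v past σ := by
  induction past using arrival_induction generalizing σ with
  | step past ih =>
    rw [continuationValue_eq_expect]
    simp only [continuationValue_announce _ r v past, Finset.mul_expect, ← Finset.expect_sum_comm]
    refine Finset.expect_congr rfl fun i hi => ?_
    set P := ∑ x ∈ remaining past, p x
    have hP : P * (p i / P) = p i :=
      mul_div_cancel_of_imp' fun h => (Finset.sum_eq_zero_iff_of_nonneg fun j _ => hp j).1 h i hi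
    have hi' : i ∉ remaining (i :: past) := by simp [remaining_cons]
    have hnot : (P - p i) * (if r past (false :: σ) then v i else
          continuationValue (announceRandom p hp) r v (i :: past) (false :: σ)) =
        ∑ x ∈ (remaining past).erase i, p x * if r past (false :: σ) then v i else
          continuationValue (announce x) r v (i :: past) (false :: σ) := by
      rw [← Finset.sum_erase_eq_sub hi]
      split_ifs
      · rw [Finset.sum_mul]
      · rw [← remaining_cons, ih i hi (by simpa using hσ)]
    rw [Fintype.sum_bool, Mechanism.signalProb, Mechanism.signalProb, if_pos rfl,
      if_neg Bool.false_ne_true, announceRandom_hireProb hp hi, if_neg hσ, mul_add, ← mul_assoc,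
      ← mul_assoc, hP, mul_one_sub, hP, hnot, ← Finset.add_sum_erase _ _ hi, decide_eq_true rfl,
      continuationValue_announceRandom_of_mem hp r v List.mem_cons_self hi']
    refine congrArg _ (Finset.sum_congr rfl fun x hx => ?_)
    rw [decide_eq_false (Finset.ne_of_mem_erase hx).symm]

theorem expectedValue_announceRandom (hsum : ∑ i, p i = 1) :
    expectedValue (announceRandom p hp) r v = ∑ x, p x * expectedValue (announce x) r v := by
  simpa only [remaining_nil, hsum, one_mul, ← expectedValue_eq_continuationValue] using
    sum_mul_continuationValue_announceRandom hp r v (past := []) List.not_mem_nil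

end RandomAnnouncement

section Symmetry

variable (r : List Bool → Bool)

theorem valueAlong_announce_map (g : Equiv.Perm (Fin n)) (x : Fin n) (v : Fin n → ℝ)
    (past : List (Fin n)) (σ : List Bool) (l : List (Fin n)) :
    valueAlong (announce (g x)) (fun _ σ => r σ) v (past.map g) σ (l.map g) =
      valueAlong (announce x) (fun _ σ => r σ) (v ∘ g) past σ l := by
  induction l generalizing past σ with
  | nil => rfl
  | cons i l ih =>
    simp only [List.map_cons, valueAlong, announce_signalProb, g.injective.eq_iff, ← ih,
      Function.comp_apply]

theorem expectedValue_announce_apply (g : Equiv.Perm (Fin n)) (x : Fin n) (v : Fin n → ℝ) :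
    expectedValue (announce (g x)) (fun _ σ => r σ) v =
      expectedValue (announce x) (fun _ σ => r σ) (v ∘ g) := by
  rw [expectedValue, expectedValue, ← Equiv.sum_comp (Equiv.mulLeft g)]
  congr 1
  refine Finset.sum_congr rfl fun π _ => ?_
  rw [← valueAlong_announce_map r g x v [] [], List.map_nil, List.map_ofFn]
  rfl

theorem expectedValue_announce_single_apply (g : Equiv.Perm (Fin n)) (x i : Fin n) :
    expectedValue (announce (g x)) (fun _ σ => r σ) (Pi.single (g i) 1) =
      expectedValue (announce x) (fun _ σ => r σ) (Pi.single i 1) := by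
  rw [expectedValue_announce_apply]
  congr 1
  funext j
  simp only [Function.comp_apply, Pi.single_apply, g.injective.eq_iff]

theorem exists_expectedValue_announce_single_eq : ∃ a b : ℝ, 0 ≤ b ∧
    ∀ x i : Fin n, expectedValue (announce x) (fun _ σ => r σ) (Pi.single i 1) =
      if i = x then a else b := by
  let H (x i : Fin n) : ℝ := expectedValue (announce x) (fun _ σ => r σ) (Pi.single i 1)
  have hH (g : Equiv.Perm (Fin n)) (x i : Fin n) : H (g x) (g i) = H x i :=
    expectedValue_announce_single_apply r g x i
  rcases isEmpty_or_nonempty (Fin n) with _ | ⟨⟨x₀⟩⟩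
  · exact ⟨0, 0, le_rfl, isEmptyElim⟩
  obtain ⟨b, hb, hne⟩ : ∃ b : ℝ, 0 ≤ b ∧ ∀ x i : Fin n, i ≠ x → H x i = b := by
    rcases subsingleton_or_nontrivial (Fin n) with _ | _
    · exact ⟨0, le_rfl, fun x i h => absurd (Subsingleton.elim i x) h⟩
    · obtain ⟨y₀, hy⟩ := exists_ne x₀
      refine ⟨H x₀ y₀, expectedValue_nonneg _ _ (Pi.single_nonneg.2 zero_le_one), ?_⟩
      intro x i hix
      obtain ⟨g, rfl, rfl⟩ := MulAction.is_two_pretransitive_iff.1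
        (Equiv.Perm.isMultiplyPretransitive (Fin n) 2) hy.symm hix.symm
      exact hH g x₀ y₀
  refine ⟨H x₀ x₀, b, hb, fun x i => ?_⟩
  split_ifs with hix
  · rw [hix, ← hH (Equiv.swap x₀ x), Equiv.swap_apply_left]
  · exact hne x i hix

theorem exists_expectedValue_announce_eq [NeZero n] :
    ∃ a b : ℝ, 0 ≤ b ∧ a + b * (n - 1) ≤ 1 ∧ ∀ (x : Fin n) (v : Fin n → ℝ),
      expectedValue (announce x) (fun _ σ => r σ) v = a * v x + b * (∑ i, v i - v x) := by
  obtain ⟨a, b, hb, hab⟩ := exists_expectedValue_announce_single_eq (n := n) r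
  have heq (x : Fin n) (v : Fin n → ℝ) :
      expectedValue (announce x) (fun _ σ => r σ) v = a * v x + b * (∑ i, v i - v x) := by
    rw [expectedValue_eq_sum, ← Finset.add_sum_erase _ _ (Finset.mem_univ x),
      ← Finset.sum_erase_eq_sub (Finset.mem_univ x), hab, if_pos rfl, Finset.mul_sum, mul_comm]
    refine congrArg _ (Finset.sum_congr rfl fun i hi => ?_)
    rw [hab, if_neg (Finset.ne_of_mem_erase hi), mul_comm]
  refine ⟨a, b, hb, ?_, heq⟩
  calc a + b * (n - 1) = expectedValue (announce (0 : Fin n)) (fun _ σ => r σ) 1 := by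
        simp [heq]
    _ ≤ 1 := expectedValue_le_of_forall_le _ _ zero_le_one fun _ => le_rfl

end Symmetry

theorem persuasiveWithoutDisclosure_announceRandom {ρ p : Fin n → ℝ} (hp : ∀ i, 0 ≤ p i)
    (hfav : IsFavorableLottery ρ Finset.univ p) (hρ : ∀ i, 0 ≤ ρ i) :
    PersuasiveWithoutDisclosure ρ (announceRandom p hp) := by
  intro r
  have : NeZero n := ⟨by rintro rfl; simpa using hfav.nonempty⟩
  obtain ⟨a, b, hb, hab, heq⟩ := exists_expectedValue_announce_eq (n := n) r
  simp only [expectedValue_announceRandom hp _ _ hfav.sum_eq_one, heq,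
    expectedValue_announce_obedient]
  have hsum := hfav.sum_le_card_mul
  rw [Finset.card_univ, Fintype.card_fin] at hsum
  set A := ∑ x, p x * ρ x
  calc ∑ x, p x * (a * ρ x + b * (∑ i, ρ i - ρ x)) =
        a * A + b * ((∑ x, p x) * ∑ i, ρ i - A) := by
        simp only [mul_add, mul_sub, Finset.sum_add_distrib, Finset.sum_sub_distrib, mul_left_comm,
          ← Finset.mul_sum, ← Finset.sum_mul]
        rfl
    _ = a * A + b * (∑ i, ρ i - A) := by rw [hfav.sum_eq_one, one_mul]
    _ ≤ a * A + b * (n * A - A) := by gcongr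
    _ = (a + b * (n - 1)) * A := by ring
    _ ≤ A := mul_le_of_le_one_left (Finset.sum_nonneg fun x _ => mul_nonneg (hp x) (hρ x)) hab

theorem IsFavorableLottery.le_OPT {ρ ξ p : Fin n → ℝ} {c : Fin n} (h : IsInstance ρ ξ)
    (hc : IsSenderBest Finset.univ ξ c) (hfav : IsFavorableLottery ρ Finset.univ p) :
    p c ≤ OPT ρ ξ := by
  have hp (i) : 0 ≤ p i := hfav.nonneg i (Finset.mem_univ i)
  refine le_csSup ⟨1, ?_⟩ ⟨announceRandom p hp,
    persuasiveWithoutDisclosure_announceRandom hp hfav h.rho_nonneg, ?_⟩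
  · rintro _ ⟨φ, -, rfl⟩
    exact successProb_le_one ξ φ
  · rw [successProb, expectedValue_announceRandom hp _ _ hfav.sum_eq_one,
      ordinalUtility_eq_single h.xi_injective hc]
    simp only [expectedValue_announce_obedient]
    simp [Pi.single_apply]

end Announcements

section Benchmark

variable {n : ℕ} {ρ ξ : Fin n → ℝ} {c : Fin n}

theorem PersuasiveWithoutDisclosure.mean_le_expectedValue {φ : Mechanism n}
    (hφ : PersuasiveWithoutDisclosure ρ φ) :
    mean Finset.univ ρ ≤ expectedValue φ obedient ρ := by
  rw [← remaining_nil, ← continuationValue_of_forall_hire φ (σ := [])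
    (r := fun _ _ => true) fun _ => rfl, ← expectedValue_eq_continuationValue]
  exact hφ fun _ => true

theorem successProb_mul_sub_le {M : Fin n} (φ : Mechanism n)
    (hξ : Function.Injective ξ) (hc : IsSenderBest Finset.univ ξ c)
    (hM : IsReceiverBest Finset.univ ρ M) (hρ : 0 ≤ ρ M) :
    successProb ξ φ * (ρ M - ρ c) ≤ ρ M - expectedValue φ obedient ρ := by
  have hlin := isLinearMap_expectedValue φ obedient
  rw [le_sub_iff_add_le', mul_comm, successProb, ordinalUtility_eq_single hξ hc, ← smul_eq_mul,
    ← hlin.map_smul, ← hlin.map_add]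
  refine expectedValue_le_of_forall_le _ _ hρ fun i => ?_
  by_cases hi : i = c
  · simp [hi]
  · simpa [hi] using hM.2 i (Finset.mem_univ i)

theorem PersuasiveWithoutDisclosure.successProb_le (h : IsInstance ρ ξ) {φ : Mechanism n}
    (hφ : PersuasiveWithoutDisclosure ρ φ) (hc : IsSenderBest Finset.univ ξ c) :
    successProb ξ φ ≤ ordinalParetoLottery ρ ξ Finset.univ c := by
  obtain ⟨M, hM⟩ := exists_isReceiverBest ⟨c, hc.1⟩ ρ
  rw [ordinalParetoLottery_senderBest h hc hM, senderProb]
  split_ifs with hle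
  · exact successProb_le_one ξ φ
  · rw [le_div_iff₀ (by linarith [hM.mean_le])]
    exact (successProb_mul_sub_le φ h.xi_injective hc hM (h.rho_nonneg M)).trans
      (sub_le_sub_left hφ.mean_le_expectedValue _)

theorem OPT_eq_ordinalParetoLottery (h : IsInstance ρ ξ) (hc : IsSenderBest Finset.univ ξ c) :
    OPT ρ ξ = ordinalParetoLottery ρ ξ Finset.univ c := by
  have hfav := isFavorableLottery_ordinalParetoLottery h ⟨c, hc.1⟩
  refine le_antisymm (Real.sSup_le ?_ (hfav.nonneg c hc.1)) (hfav.le_OPT h hc)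
  rintro _ ⟨φ, hφ, rfl⟩
  exact hφ.successProb_le h hc

theorem OPT_mul_le_successProb_shrinkingPareto (hn : 1 ≤ n) (h : IsInstance ρ ξ) :
    OPT ρ ξ * (1 / 2 - 1 / (2 * n)) ≤ successProb ξ (shrinkingPareto ρ ξ) := by
  obtain ⟨c, hc⟩ := exists_isSenderBest ⟨⟨0, hn⟩, Finset.mem_univ _⟩ ξ
  rw [OPT_eq_ordinalParetoLottery h hc]
  exact ordinalParetoLottery_mul_le_successProb h hc

end Benchmark

section Delay

variable {n : ℕ} (φ : Mechanism n) (c : Fin n)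

/-- The deviation that exploits disclosure: obey once `c` is among the rejected candidates, but
before that answer the HIRE signal by waiting for the next candidate and hiring that one. -/
def delayStrategy {n : ℕ} (c : Fin n) : Strategy n
  | _, [] => false
  | past, s :: σ => if true ∈ σ then true else if c ∈ past then s else false

variable {c} {past : List (Fin n)} {σ : List Bool}

theorem continuationValue_delayStrategy_of_hired (hσ : true ∈ σ) (v : Fin n → ℝ) :
    continuationValue φ (delayStrategy c) v past σ = mean (remaining past) v :=
  continuationValue_of_forall_hire φ (fun _ => if_pos hσ) v

theorem continuationValue_delayStrategy_of_mem (hc : c ∈ past) (hσ : true ∉ σ) (v : Fin n → ℝ) :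
    continuationValue φ (delayStrategy c) v past σ = continuationValue φ obedient v past σ := by
  induction past using arrival_induction generalizing σ with
  | step past ih =>
    rw [continuationValue_eq_expect, continuationValue_obedient]
    refine Finset.expect_congr rfl fun i hi => ?_
    have hrest := ih i hi (List.mem_cons_of_mem i hc) (σ := false :: σ) (by simpa using hσ)
    simp [delayStrategy, Mechanism.signalProb, hσ, hc, hrest]

theorem continuationValue_delayStrategy_of_notMem (hc : c ∉ past) (hσ : true ∉ σ)
    (v : Fin n → ℝ) :
    continuationValue φ (delayStrategy c) v past σ = 𝔼 i ∈ remaining past,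
      (φ.hireProb (i :: past) σ * mean ((remaining past).erase i) v +
        (1 - φ.hireProb (i :: past) σ) *
          continuationValue φ (delayStrategy c) v (i :: past) (false :: σ)) := by
  rw [continuationValue_eq_expect]
  refine Finset.expect_congr rfl fun i _ => ?_
  have hhired := continuationValue_delayStrategy_of_hired φ (c := c) (past := i :: past)
    (List.mem_cons_self (a := true) (l := σ)) v
  simp [delayStrategy, Mechanism.signalProb, hσ, hc, hhired, remaining_cons]

theorem continuationValue_sub_delayStrategy_eq (hc : c ∉ past) (hσ : true ∉ σ)
    (ρ w : Fin n → ℝ) :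
    continuationValue φ obedient w past σ - continuationValue φ (delayStrategy c) ρ past σ =
      𝔼 i ∈ remaining past,
        (φ.hireProb (i :: past) σ * (w i - mean ((remaining past).erase i) ρ) +
          (1 - φ.hireProb (i :: past) σ) *
            (continuationValue φ obedient w (i :: past) (false :: σ) -
              continuationValue φ (delayStrategy c) ρ (i :: past) (false :: σ))) := by
  rw [continuationValue_obedient, continuationValue_delayStrategy_of_notMem φ hc hσ,
    ← Finset.expect_sub_distrib]
  exact Finset.expect_congr rfl fun i _ => by ring

variable {ρ w : Fin n → ℝ} {R : Finset (Fin n)}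

theorem sub_div_card_le_mean (hc : c ∈ R) (hρc : 0 ≤ ρ c) (hw : ∀ j, j ≠ c → w j = ρ j)
    (hmin : ∀ j, w c ≤ w j) : w c - w c / R.card ≤ mean R ρ := by
  have hcard : (0 : ℝ) < R.card := Nat.cast_pos.2 (Finset.card_pos.2 ⟨c, hc⟩)
  have hsum : ∑ j ∈ R, ρ j = ∑ j ∈ R, w j + (ρ c - w c) := by
    rw [← Finset.add_sum_erase _ _ hc, ← Finset.add_sum_erase _ w hc,
      Finset.sum_congr rfl fun j hj => hw j (Finset.ne_of_mem_erase hj)]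
    ring
  have hle : R.card * w c ≤ ∑ j ∈ R, w j := by
    rw [← nsmul_eq_mul]
    exact Finset.card_nsmul_le_sum _ _ _ fun j _ => hmin j
  rw [mean, hsum, le_div_iff₀ hcard, sub_mul, div_mul_cancel₀ _ hcard.ne', mul_comm]
  linarith

theorem le_mean_erase (hc : c ∈ R) (hR : R.card ≠ 1) (hw : ∀ j, j ≠ c → w j = ρ j)
    (hmin : ∀ j, w c ≤ w j) : w c ≤ mean (R.erase c) ρ := by
  have hcard := Finset.card_pos.2 ⟨c, hc⟩
  rw [mean_eq_expect]
  refine Finset.le_expect ?_ fun j hj => hw j (Finset.ne_of_mem_erase hj) ▸ hmin j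
  exact (Finset.erase_nonempty hc).2 (Finset.one_lt_card_iff_nontrivial.1 (by omega))

theorem sub_mean_erase_le {i : Fin n} (hi : i ∈ R) (hc : c ∈ R) (hic : i ≠ c) (hρc : 0 ≤ ρ c)
    (hw : ∀ j, j ≠ c → w j = ρ j) (hmin : ∀ j, w c ≤ w j) :
    w i - mean (R.erase i) ρ ≤
      w c / (R.card - 1) + (∑ j ∈ R, (w j - w c)) / 2 + (w i - w c) / 2 := by
  have hmean := sub_div_card_le_mean (Finset.mem_erase.2 ⟨hic.symm, hc⟩) hρc hw hmin
  have hexcess := Finset.single_le_sum (f := fun j => w j - w c)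
    (fun j _ => sub_nonneg.2 (hmin j)) hi
  rw [Finset.cast_card_erase_of_mem hi] at hmean
  linarith

theorem continuationValue_eq_delayStrategy (hw : ∀ j, j ≠ c → w j = ρ j) (hc : c ∈ past)
    (hσ : true ∉ σ) :
    continuationValue φ obedient w past σ = continuationValue φ (delayStrategy c) ρ past σ := by
  rw [continuationValue_delayStrategy_of_mem φ hc hσ]
  refine continuationValue_congr φ _ (fun i hi => hw i ?_) σ
  rintro rfl
  exact mem_remaining.1 hi hc

theorem expect_le_two_mul_div_card_add {f e : Fin n → ℝ} {b : ℝ} (hc : c ∈ R) (hR : R.card ≠ 1)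
    (he : e c = 0) (hfc : f c ≤ 0)
    (hf : ∀ i ∈ R, i ≠ c → f i ≤ b / (R.card - 1) + (∑ j ∈ R, e j) / 2 + e i / 2) :
    𝔼 i ∈ R, f i ≤ b / R.card + (∑ j ∈ R, e j) / 2 := by
  have hcard : (0 : ℝ) < R.card := Nat.cast_pos.2 (Finset.card_pos.2 ⟨c, hc⟩)
  have hcard' : (R.card - 1 : ℝ) ≠ 0 := sub_ne_zero.2 (mod_cast hR)
  have hsum : ∑ i ∈ R.erase c, f i ≤ ∑ i ∈ R.erase c,
      (b / (R.card - 1) + (∑ j ∈ R, e j) / 2 + e i / 2) :=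
    Finset.sum_le_sum fun i hi => hf i (Finset.mem_of_mem_erase hi) (Finset.ne_of_mem_erase hi)
  rw [Finset.sum_add_distrib, Finset.sum_const, nsmul_eq_mul, Finset.cast_card_erase_of_mem hc,
    ← Finset.sum_div, Finset.sum_erase _ he, mul_add, mul_div_cancel₀ _ hcard'] at hsum
  rw [Finset.expect_eq_sum_div_card, div_le_iff₀ hcard, add_mul, div_mul_cancel₀ _ hcard.ne',
    ← Finset.add_sum_erase _ _ hc]
  linarith

theorem continuationValue_sub_delayStrategy_le (hρc : 0 ≤ ρ c) (hw : ∀ j, j ≠ c → w j = ρ j)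
    (hwc : 0 ≤ w c) (hmin : ∀ j, w c ≤ w j) (hc : c ∉ past) (hσ : true ∉ σ) :
    continuationValue φ obedient w past σ - continuationValue φ (delayStrategy c) ρ past σ ≤
      2 * w c / (remaining past).card + (∑ j ∈ remaining past, (w j - w c)) / 2 := by
  induction past using arrival_induction generalizing σ with
  | step past ih =>
    have hcR := mem_remaining.2 hc
    have hσ' : true ∉ false :: σ := by simpa using hσ
    rw [continuationValue_sub_delayStrategy_eq φ hc hσ]
    have hwait := continuationValue_eq_delayStrategy φ hw (List.mem_cons_self (l := past)) hσ'
    by_cases hone : (remaining past).card = 1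
    · obtain ⟨x, hx⟩ := Finset.card_eq_one.1 hone
      obtain rfl : c = x := by simpa [hx] using hcR
      have hp := mul_le_of_le_one_left hwc (φ.hireProb_le_one (c :: past) σ)
      rw [hx, Finset.expect_singleton, hwait, Finset.erase_singleton, Finset.sum_singleton,
        Finset.card_singleton, mean, Finset.sum_empty, zero_div, sub_zero, sub_self, sub_self,
        mul_zero, add_zero, zero_div, add_zero, Nat.cast_one, div_one]
      linarith
    · refine expect_le_two_mul_div_card_add hcR hone (sub_self _) ?_ fun i hi hic => ?_
      · have hmean := le_mean_erase hcR hone hw hmin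
        rw [hwait, sub_self, mul_zero, add_zero]
        exact mul_nonpos_of_nonneg_of_nonpos (φ.hireProb_nonneg _ _) (sub_nonpos.2 hmean)
      · have hlater := ih i hi (by simp [hc, hic.symm]) hσ'
        have hhired := sub_mean_erase_le hi hcR hic hρc hw hmin
        have hnonneg : 0 ≤ w c / ((remaining past).card - 1) :=
          div_nonneg hwc (sub_nonneg.2 (Nat.one_le_cast.2 (Finset.card_pos.2 ⟨c, hcR⟩)))
        rw [remaining_cons, Finset.cast_card_erase_of_mem hi, Finset.sum_erase_eq_sub hi,
          mul_div_assoc] at hlater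
        refine convex_Iic (𝕜 := ℝ) (_ : ℝ) ?_ ?_ (φ.hireProb_nonneg (i :: past) σ)
          (sub_nonneg.2 (φ.hireProb_le_one _ _)) (add_sub_cancel _ _)
        · rw [Set.mem_Iic, mul_div_assoc]
          linarith
        · rw [Set.mem_Iic, mul_div_assoc]
          linarith [hmin i]

theorem PersuasiveWithDisclosure.mul_successProb_le {ξ : Fin n → ℝ} {φ : Mechanism n}
    (hφ : PersuasiveWithDisclosure ρ φ) (hξ : Function.Injective ξ)
    (hc : IsSenderBest Finset.univ ξ c) (hρc : 0 ≤ ρ c) (hw : ∀ j, j ≠ c → w j = ρ j)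
    (hwc : 0 ≤ w c) (hmin : ∀ j, w c ≤ w j) :
    (w c - ρ c) * successProb ξ φ ≤ 2 * w c / n + (∑ j, (w j - w c)) / 2 := by
  have hgap := continuationValue_sub_delayStrategy_le φ hρc hw hwc hmin (past := []) (σ := [])
    List.not_mem_nil List.not_mem_nil
  have hdecomp : w = ρ + (w c - ρ c) • ordinalUtility Finset.univ ξ := by
    rw [ordinalUtility_eq_single hξ hc]
    ext j
    by_cases hj : j = c
    · simp [hj]
    · simp [hj, hw j hj]
  have hlin := isLinearMap_expectedValue φ obedient
  have hraised : expectedValue φ obedient w =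
      expectedValue φ obedient ρ + (w c - ρ c) * successProb ξ φ := by
    conv_lhs => rw [hdecomp]
    rw [hlin.map_add, hlin.map_smul, smul_eq_mul, successProb]
  rw [← expectedValue_eq_continuationValue, ← expectedValue_eq_continuationValue, hraised,
    remaining_nil, Finset.card_univ, Fintype.card_fin] at hgap
  linarith [hφ (delayStrategy c)]

end Delay

section HardInstance

theorem one_sub_mean_le_OPT {n : ℕ} {ρ ξ : Fin n → ℝ} (h : IsInstance ρ ξ) {M : Fin n}
    (hM : IsReceiverBest Finset.univ ρ M) (hρM : ρ M = 1) :
    1 - mean Finset.univ ρ ≤ OPT ρ ξ := by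
  obtain ⟨c, hc⟩ := exists_isSenderBest ⟨M, hM.1⟩ ξ
  have hmean := hM.mean_le
  rw [OPT_eq_ordinalParetoLottery h hc, ordinalParetoLottery_senderBest h hc hM, senderProb]
  rw [hρM] at hmean ⊢
  split_ifs with hle
  · rw [sub_le_self_iff, mean_eq_expect]
    exact Finset.expect_nonneg fun i _ => h.rho_nonneg i
  · exact le_div_self (sub_nonneg.2 hmean) (by linarith) (by linarith [h.rho_nonneg c])

/-- Receiver values that are `1` for candidate `1` and almost equal to `1 - h` for all others, the
summand `i / n ^ 3` serving only to make them distinct. -/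
noncomputable def clusteredValue (n : ℕ) (h : ℝ) (i : Fin n) : ℝ :=
  if (i : ℕ) = 1 then 1 else 1 - h + i / n ^ 3

variable {n : ℕ} {h : ℝ}

theorem div_pow_three_lt (i : Fin n) : (i : ℝ) / n ^ 3 < 1 / n ^ 2 := by
  have hi : (i : ℝ) < n := by exact_mod_cast i.2
  have hn : (0 : ℝ) < n := (Nat.cast_nonneg _).trans_lt hi
  rw [div_lt_div_iff₀ (by positivity) (by positivity), one_mul, pow_succ' _ 2]
  gcongr

theorem le_clusteredValue (h0 : 0 ≤ h) (i : Fin n) : 1 - h ≤ clusteredValue n h i := by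
  have hdiv : (0 : ℝ) ≤ i / n ^ 3 := by positivity
  rw [clusteredValue]
  split_ifs <;> linarith

theorem clusteredValue_le_one (hn : 1 / (n : ℝ) ^ 2 < h) (i : Fin n) :
    clusteredValue n h i ≤ 1 := by
  rw [clusteredValue]
  split_ifs <;> linarith [div_pow_three_lt i]

theorem clusteredValue_injective (hn : 1 / (n : ℝ) ^ 2 < h) :
    Function.Injective (clusteredValue n h) := by
  intro i j hij
  have hi := div_pow_three_lt i
  have hj := div_pow_three_lt j
  have hpos : (n : ℝ) ≠ 0 := Nat.cast_ne_zero.2 (i.pos).ne'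
  unfold clusteredValue at hij
  split_ifs at hij
  · ext; omega
  · linarith
  · linarith
  · rw [add_right_inj, div_left_inj' (pow_ne_zero 3 hpos)] at hij
    exact Fin.ext (Nat.cast_injective hij)

theorem sum_clusteredValue_sub_le (hn : 1 < n) (h : ℝ) :
    ∑ i, (clusteredValue n h i - (1 - h)) ≤ h + 1 / n := by
  have hpos : (0 : ℝ) < n := Nat.cast_pos.2 (Nat.zero_lt_of_lt hn)
  calc ∑ i, (clusteredValue n h i - (1 - h))
      ≤ ∑ i, ((if i = (⟨1, hn⟩ : Fin n) then h else 0) + 1 / (n : ℝ) ^ 2) := by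
        refine Finset.sum_le_sum fun i _ => ?_
        have hdiv := div_pow_three_lt i
        have hpow : 0 < 1 / (n : ℝ) ^ 2 := one_div_pos.2 (pow_pos hpos 2)
        simp only [clusteredValue, Fin.ext_iff]
        split_ifs <;> linarith
    _ = h + 1 / n := by
        simp only [Finset.sum_add_distrib, Finset.sum_ite_eq', Finset.mem_univ, if_true,
          Finset.sum_const, Finset.card_univ, Fintype.card_fin, nsmul_eq_mul]
        field_simp

/-- Receiver values of the hard instance: the sender-optimal candidate `0` is worthless, and the
others have clustered values. -/
noncomputable def hardValue (n : ℕ) (h : ℝ) (i : Fin n) : ℝ :=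
  if (i : ℕ) = 0 then 0 else clusteredValue n h i

theorem hardValue_le_clusteredValue (h0 : 0 ≤ h) (h1 : h ≤ 1) (i : Fin n) :
    hardValue n h i ≤ clusteredValue n h i := by
  rw [hardValue]
  split_ifs
  · linarith [le_clusteredValue h0 i]
  · rfl

theorem isInstance_hardValue (h1 : h < 1) (hn : 1 / (n : ℝ) ^ 2 < h) :
    IsInstance (hardValue n h) fun i => n - i where
  rho_nonneg i := by
    have h0 : 0 ≤ h := le_trans (by positivity) hn.le
    rw [hardValue]
    split_ifs
    · rfl
    · linarith [le_clusteredValue h0 i]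
  xi_nonneg i := sub_nonneg.2 (Nat.cast_le.2 i.is_le')
  rho_injective i j hij := by
    have hpos (k : Fin n) : 0 < clusteredValue n h k :=
      (sub_pos.2 h1).trans_le (le_clusteredValue (le_trans (by positivity) hn.le) k)
    unfold hardValue at hij
    split_ifs at hij
    · ext; omega
    · exact absurd hij (hpos j).ne
    · exact absurd hij (hpos i).ne'
    · exact clusteredValue_injective hn hij
  xi_injective i j hij := Fin.ext (Nat.cast_injective (sub_right_injective hij))

theorem sub_two_div_le_OPT_hardValue (h1 : h < 1) (hn : 1 < n) (hnh : 1 / (n : ℝ) ^ 2 < h) :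
    h - 2 / n ≤ OPT (hardValue n h) fun i => n - i := by
  have h0 : 0 ≤ h := le_trans (by positivity) hnh.le
  have hpos : (1 : ℝ) < n := Nat.one_lt_cast.2 hn
  have hM : hardValue n h ⟨1, hn⟩ = 1 := by simp [hardValue, clusteredValue]
  have hbest : IsReceiverBest Finset.univ (hardValue n h) ⟨1, hn⟩ :=
    ⟨Finset.mem_univ _, fun i _ => hM ▸
      (hardValue_le_clusteredValue h0 h1.le i).trans (clusteredValue_le_one hnh i)⟩
  have hsum : ∑ i, hardValue n h i ≤ n * (1 - h) + 2 := by
    have hexcess := sum_clusteredValue_sub_le hn h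
    have hinv : 1 / (n : ℝ) < 1 := (div_lt_one (by linarith)).2 hpos
    rw [Finset.sum_sub_distrib, Finset.sum_const, Finset.card_univ, Fintype.card_fin,
      nsmul_eq_mul] at hexcess
    linarith [Finset.sum_le_sum fun i (_ : i ∈ Finset.univ) =>
      hardValue_le_clusteredValue (n := n) h0 h1.le i]
  have hmean : mean Finset.univ (hardValue n h) ≤ 1 - h + 2 / n := by
    rw [mean, Finset.card_univ, Fintype.card_fin, div_le_iff₀ (by linarith)]
    refine hsum.trans_eq ?_
    field_simp
  linarith [one_sub_mean_le_OPT (isInstance_hardValue h1 hnh) hbest hM]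

theorem PersuasiveWithDisclosure.successProb_hardValue_le {φ : Mechanism n}
    (hφ : PersuasiveWithDisclosure (hardValue n h) φ) (h0 : 0 ≤ h) (h1 : h ≤ 1) (hn : 1 < n) :
    (1 - h) * successProb (fun i => (n : ℝ) - i) φ ≤ 2 * (1 - h) / n + (h + 1 / n) / 2 := by
  set c : Fin n := ⟨0, Nat.zero_lt_of_lt hn⟩ with hc
  have hρc : hardValue n h c = 0 := if_pos rfl
  have hwc : clusteredValue n h c = 1 - h := by simp [clusteredValue, hc]
  have hbest : IsSenderBest Finset.univ (fun i : Fin n => (n : ℝ) - i) c :=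
    ⟨Finset.mem_univ _, fun j _ => by simp [hc]⟩
  have hbound := hφ.mul_successProb_le (w := clusteredValue n h)
    (fun i j hij => Fin.ext (Nat.cast_injective (sub_right_injective hij))) hbest hρc.ge
    (fun j hj => (if_neg fun hj0 => hj (Fin.ext hj0)).symm)
    (by linarith) (fun j => hwc ▸ le_clusteredValue h0 j)
  rw [hρc, hwc, sub_zero] at hbound
  linarith [sum_clusteredValue_sub_le hn h]

theorem exists_hard_instance {ε : ℝ} (hε : 0 < ε) : ∃ N : ℕ, ∀ n : ℕ, N ≤ n →
    ∃ ρ ξ : Fin n → ℝ, IsInstance ρ ξ ∧ ∀ φ : Mechanism n, PersuasiveWithDisclosure ρ φ →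
      successProb ξ φ ≤ (1 / 2 + ε) * OPT ρ ξ := by
  obtain ⟨h, h0, h1, hfactor⟩ : ∃ h : ℝ, 0 < h ∧ h < 1 ∧ (1 - h) * (1 / 2 + ε) = (1 + ε) / 2 :=
    ⟨ε / (1 + 2 * ε), by positivity, (div_lt_one (by linarith)).2 (by linarith), by
      field_simp; ring⟩
  obtain ⟨N, hN⟩ := exists_nat_gt ((7 + 2 * ε) / (ε * h))
  refine ⟨N, fun n hNn => ?_⟩
  have hlarge : (7 + 2 * ε) / (ε * h) < n := hN.trans_le (Nat.cast_le.2 hNn)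
  have hpos : (0 : ℝ) < n := lt_trans (by positivity) hlarge
  rw [div_lt_comm₀ (by positivity) hpos, add_div] at hlarge
  have htwo : 2 / (n : ℝ) < h := by
    have hterm : 0 < 7 / (n : ℝ) := by positivity
    refine lt_of_mul_lt_mul_left ?_ hε.le
    calc ε * (2 / n) = 2 * ε / n := by ring
      _ < ε * h := by linarith
  have hn : 2 < (n : ℝ) := by simpa using (div_lt_iff₀ hpos).1 (htwo.trans h1)
  have hsq : 1 / (n : ℝ) ^ 2 < h := by
    refine lt_of_le_of_lt ?_ htwo
    rw [div_le_div_iff₀ (by positivity) hpos]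
    nlinarith
  have hn' : 1 < n := Nat.one_lt_cast.1 (one_lt_two.trans hn)
  refine ⟨hardValue n h, fun i => n - i, isInstance_hardValue h1 hsq, fun φ hφ => ?_⟩
  refine le_of_mul_le_mul_left ?_ (sub_pos.2 h1)
  calc (1 - h) * successProb (fun i => (n : ℝ) - i) φ
      ≤ 2 * (1 - h) / n + (h + 1 / n) / 2 := hφ.successProb_hardValue_le h0.le h1.le hn'
    _ = (1 + ε) / 2 * (h - 2 / n) - (ε * h - (7 / n + 2 * ε / n)) / 2 - h * (2 / n) := by ring
    _ ≤ (1 + ε) / 2 * (h - 2 / n) := by linarith [mul_pos h0 (div_pos two_pos hpos)]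
    _ ≤ (1 + ε) / 2 * OPT (hardValue n h) fun i => n - i := by
        gcongr
        exact sub_two_div_le_OPT_hardValue h1 hn' hsq
    _ = _ := by rw [← hfactor, mul_assoc]

end HardInstance

end OnlinePersuasion

theorem mainTheorem8 :
    (∀ (n : ℕ), 1 ≤ n → ∀ (ρ ξ : Fin n → ℝ), OnlinePersuasion.IsInstance ρ ξ →
      OnlinePersuasion.PersuasiveWithDisclosure ρ (OnlinePersuasion.shrinkingPareto ρ ξ) ∧
      OnlinePersuasion.OPT ρ ξ * (1 / 2 - 1 / (2 * (n : ℝ))) ≤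
        OnlinePersuasion.successProb ξ (OnlinePersuasion.shrinkingPareto ρ ξ)) ∧
    (∀ ε : ℝ, 0 < ε → ∃ N : ℕ, ∀ n : ℕ, N ≤ n → ∃ ρ ξ : Fin n → ℝ,
      OnlinePersuasion.IsInstance ρ ξ ∧
      ∀ φ : OnlinePersuasion.Mechanism n, OnlinePersuasion.PersuasiveWithDisclosure ρ φ →
        OnlinePersuasion.successProb ξ φ ≤ (1 / 2 + ε) * OnlinePersuasion.OPT ρ ξ) := by
  refine ⟨fun n hn ρ ξ h => ⟨?persuasive, ?success⟩, fun ε hε => ?optimal⟩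
  case persuasive => exact OnlinePersuasion.persuasiveWithDisclosure_shrinkingPareto h
  case success => exact OnlinePersuasion.OPT_mul_le_successProb_shrinkingPareto hn h
  case optimal => exact OnlinePersuasion.exists_hard_instance hε
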